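/- For integers $n\ge 1$, $k\ge 0$ and $p\in[0,1]$ let $\mathcal A(n,k,p)$ be the set of all probability distributions $Q$ of $n$ bits $(X_1,\dots,X_n)\in\{0,1\}^n$ such that any at most $k$ of the bits are independent under $Q$ and $Q(X_i=1)=p$ for every $i$. For odd $n$ let $\mathrm{Maj}_n$ be the majority function, which is $1$ exactly when $X_1+\dots+X_n>n/2$. Theorem. There is an absolute constant $C>0$ such that for every odd $n$ and every even $k$ with $2\le k<n$, the maximum below exists and $$\frac{C}{\sqrt{k\log k}}\;\le\;\max_{Q\in\mathcal A(n,k,\frac12)}\left|Q(\mathrm{Maj}_n=1)-\tfrac12\right|\;\le\;\frac{2\sqrt2}{\sqrt k}.$$ Moreover, for every odd $n\ge 3$, let $Q_0$ be the XOR0 distribution, under which $X_1,\dots,X_{n-1}$ are independent unbiased bits and $X_n\equiv X_1+\dots+X_{n-1}\pmod 2$. Then $Q_0\in\mathcal A(n,n-1,\frac12)$ and $$\left|Q_0(\mathrm{Maj}_n=1)-\tfrac12\right|\ge\frac{1}{3\sqrt n}.$$ -/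

import Mathlib

open MeasureTheory ProbabilityTheory

namespace KWiseBits

/-- `kWise n k p` is the set `A(n, k, p)` of all probability distributions of `n` bits
`(X_1, …, X_n)` under which any at most `k` of the bits are independent and each bit equals `1`
(`true`) with probability `p`. The sample space is `{0,1}^n`, and `X_i` is the `i`-th coordinate. -/
def kWise (n k : ℕ) (p : ℝ) : Set (ProbabilityMeasure (Fin n → Bool)) :=
  {Q | (∀ T : Finset (Fin n), T.card ≤ k →
          iIndepFun (fun (i : T) (x : Fin n → Bool) => x i) (Q : Measure (Fin n → Bool))) ∧
       ∀ i : Fin n, (Q : Measure (Fin n → Bool)).real {x | x i = true} = p}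

/-- The majority function on `n` bits (used for odd `n`): it is `1` when more than `n / 2` of the
bits are `1`. -/
def maj {n : ℕ} (x : Fin n → Bool) : Bool :=
  decide (n < 2 * (Finset.univ.filter fun i => x i = true).card)

/-- The deviation `|Q(Maj_n = 1) - 1/2|`. -/
noncomputable def majDev {n : ℕ} (Q : ProbabilityMeasure (Fin n → Bool)) : ℝ :=
  |(Q : Measure (Fin n → Bool)).real {x | maj x = true} - 1 / 2|

/-- Replace the last bit of `x` by the sum modulo `2` of all the other bits. -/
def xorLast {n : ℕ} (x : Fin n → Bool) : Fin n → Bool := fun i =>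
  if i.val + 1 < n then x i
  else decide (Odd (Finset.univ.filter fun j : Fin n => j.val + 1 < n ∧ x j = true).card)

/-- The distribution XOR0: the first `n - 1` bits are independent and unbiased and the last bit is
their sum modulo `2`. It is the law of `xorLast x` for a uniformly random `x` in `{0,1}^n`. -/
noncomputable def xor0 (n : ℕ) : ProbabilityMeasure (Fin n → Bool) :=
  ⟨((PMF.uniformOfFintype (Fin n → Bool)).map xorLast).toMeasure, inferInstance⟩

end KWiseBits

/-!
The argument is Fourier analysis on the cube `{0,1}^n`. A distribution lies in `A(n, k, 1/2)` exactly
when its vector of point masses annihilates all Walsh characters `χ_T` with `1 ≤ |T| ≤ k`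
(`mem_kWise_iff`). The admissible point-mass vectors form a compact slice of the simplex, so the
maximum exists, and the deviation is half of `|E sgn(S)|`, where `S` is the sum of the bits written
as signs (`majDev_eq`).

*Upper bound.* Let `P` be a real polynomial of degree at most `k / 4` with `P(-s) ≥ 1` for
`s ≥ 0`, and put `Ω(t) = P(t)²`. For fixed `y` the function
`S (Ω(-y²) - Ω(S²)) / (y² + S²)` is an odd polynomial in `S` of degree at most `k`, so its mean is
zero, and since `Ω(-y²) ≥ 1` this gives `|E [S / (y² + S²)]| ≤ E [|S| Ω(S²) / (y² + S²)]`.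
Integrating over `y > 0`, where `∫ s / (y² + s²) dy = (π / 2) sgn s`, yields
`|E sgn(S)| ≤ E Ω(S²)` (`Balanced.abs_sum_sign_le`), and the right-hand side may be computed for
independent bits. For `P` one takes the Christoffel–Darboux kernel at the origin of the Krawtchouk
polynomials. Their three-term recurrence has positive coefficients along the imaginary axis, which
gives `P(-s) ≥ 1`, and orthogonality gives `E Ω(S²) ≤ 1 / ∑_{i ≤ k/4} C(2i, i) 4^{-i}`
(`exists_christoffel`), which is of order `1 / √k`.

*Lower bound.* For independent bits the correlation of `sgn(S)` with `sin(θ S)` satisfies a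
recurrence in `n` with nonnegative terms (`signSin_succ`). At `θ = π / 2` the sine is, up to a sign,
the parity character, and the deviation of XOR0 comes out exactly as a central binomial coefficient
(`majDev_xor0`); this settles the case `n ≤ 64 k`. For `n > 64 k` one takes `tan θ = 8 √(k / n)`,
where the correlation is still of order `1 / √k` (`le_signSin_arctan`). The function `sin(θ S)` is
not orthogonal to the low degrees, but it becomes so after subtracting a combination of sines of
smaller frequencies: since `E [χ_T ∏ (1 + i τ σ_j)] = (i τ)^|T|`, Newton's forward difference formula
extrapolates these correlations exactly from the nodes `τ = 0, h, …, k h` to `τ = 8 k h`. The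
normalization `(1 + τ²)^{-n/2}` makes the subtracted combination exponentially small in `k`
(`extrapolation_error_le`), and what remains, divided by two, is a perturbation of the uniform
density. This lower bound is of order `1 / √k`, which is stronger than required.
-/

namespace KWiseBits

open Finset

/-! ### Walsh characters and point masses -/

/-- The sign `±1` of a bit, `+1` for `true`. -/
def spin (b : Bool) : ℝ := if b then 1 else -1

/-- The Walsh character `χ_T(x) = ∏_{i ∈ T} ±1` of the cube `{0,1}^n`. -/
def walsh {n : ℕ} (T : Finset (Fin n)) (x : Fin n → Bool) : ℝ := ∏ i ∈ T, spin (x i)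

/-- The sum of the signs of the bits: the number of ones minus the number of zeros. -/
def spinSum {n : ℕ} (x : Fin n → Bool) : ℝ := ∑ i, spin (x i)

/-- The vector of point masses of a distribution on `{0,1}^n`. -/
noncomputable def mass {n : ℕ} (Q : ProbabilityMeasure (Fin n → Bool)) (x : Fin n → Bool) : ℝ :=
  (Q : Measure (Fin n → Bool)).real {x}

/-- The weight `w` on the cube annihilates the nonconstant Walsh characters of degree at most `k`.
For a probability vector this says that any `k` of the bits are independent and unbiased. -/
def Balanced {n : ℕ} (k : ℕ) (w : (Fin n → Bool) → ℝ) : Prop :=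
  ∀ T : Finset (Fin n), T.Nonempty → T.card ≤ k → ∑ x, w x * walsh T x = 0

@[simp] lemma spin_true : spin true = 1 := rfl
@[simp] lemma spin_false : spin false = -1 := rfl

lemma spin_mul_self (b : Bool) : spin b * spin b = 1 := by cases b <;> simp

lemma spin_not (b : Bool) : spin (!b) = -spin b := by cases b <;> simp

variable {n : ℕ}

@[simp] lemma walsh_empty (x : Fin n → Bool) : walsh ∅ x = 1 := by simp [walsh]

lemma walsh_mul_walsh (T U : Finset (Fin n)) (x : Fin n → Bool) :
    walsh T x * walsh U x = walsh (symmDiff T U) x := by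
  have key (V : Finset (Fin n)) : walsh V x = ∏ i, if i ∈ V then spin (x i) else 1 := by
    simp [walsh, Finset.prod_ite_mem]
  rw [key, key, key, ← Finset.prod_mul_distrib]
  refine Finset.prod_congr rfl fun i _ => ?_
  by_cases h1 : i ∈ T <;> by_cases h2 : i ∈ U <;> simp [h1, h2, mem_symmDiff, spin_mul_self]

lemma sum_cube_prod {R : Type*} [CommSemiring R] (f : Fin n → Bool → R) :
    ∑ x : Fin n → Bool, ∏ i, f i (x i) = ∏ i, (f i true + f i false) := by
  have := Finset.prod_univ_sum (fun _ : Fin n => (Finset.univ : Finset Bool)) f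
  rw [Fintype.piFinset_univ] at this
  rw [← this]
  simp

lemma sum_walsh {T : Finset (Fin n)} (hT : T.Nonempty) : ∑ x, walsh T x = 0 := by
  have key (x : Fin n → Bool) : walsh T x = ∏ i, if i ∈ T then spin (x i) else 1 := by
    simp [walsh, Finset.prod_ite_mem]
  simp_rw [key]
  rw [sum_cube_prod (fun i b => if i ∈ T then spin b else 1)]
  obtain ⟨i, hi⟩ := hT
  exact Finset.prod_eq_zero (Finset.mem_univ i) (by simp [hi])

lemma sum_walsh_mul_walsh (T U : Finset (Fin n)) :
    ∑ x, walsh T x * walsh U x = if T = U then 2 ^ n else 0 := by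
  simp_rw [walsh_mul_walsh]
  split_ifs with h
  · simp [h]
  · refine sum_walsh (Finset.nonempty_iff_ne_empty.2 fun h' => h ?_)
    exact symmDiff_eq_bot.1 h'

lemma integral_eq_sum_mass (Q : ProbabilityMeasure (Fin n → Bool)) (f : (Fin n → Bool) → ℝ) :
    ∫ x, f x ∂(Q : Measure (Fin n → Bool)) = ∑ x, mass Q x * f x := by
  rw [integral_fintype .of_finite]; simp [mass]

lemma mass_nonneg (Q : ProbabilityMeasure (Fin n → Bool)) (x : Fin n → Bool) : 0 ≤ mass Q x :=
  measureReal_nonneg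

lemma real_eq_sum_mass (Q : ProbabilityMeasure (Fin n → Bool)) (s : Set (Fin n → Bool))
    [DecidablePred (· ∈ s)] :
    (Q : Measure (Fin n → Bool)).real s = ∑ x, mass Q x * if x ∈ s then 1 else 0 := by
  have h : s = ↑(Finset.univ.filter (· ∈ s)) := by ext; simp
  conv_lhs => rw [h, ← sum_measureReal_singleton]
  rw [Finset.sum_filter]
  simp [mass]

lemma sum_mass (Q : ProbabilityMeasure (Fin n → Bool)) : ∑ x, mass Q x = 1 := by
  classical
  have := real_eq_sum_mass Q Set.univ
  simpa using this.symm

lemma exists_mass_eq {w : (Fin n → Bool) → ℝ} (hw : ∀ x, 0 ≤ w x) (h1 : ∑ x, w x = 1) :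
    ∃ Q : ProbabilityMeasure (Fin n → Bool), mass Q = w := by
  have hs : ∑ x, ENNReal.ofReal (w x) = 1 := by
    rw [← ENNReal.ofReal_sum_of_nonneg fun x _ => hw x, h1, ENNReal.ofReal_one]
  refine ⟨⟨(PMF.ofFintype _ hs).toMeasure, inferInstance⟩, funext fun x => ?_⟩
  simp only [mass, ProbabilityMeasure.coe_mk, measureReal_def]
  rw [PMF.toMeasure_apply_singleton _ _ (MeasurableSet.singleton x), PMF.ofFintype_apply,
    ENNReal.toReal_ofReal (hw x)]

/-! ### Independence in terms of Walsh characters -/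

lemma integral_spin {Q : ProbabilityMeasure (Fin n → Bool)} {i : Fin n}
    (h : (Q : Measure (Fin n → Bool)).real {x | x i = true} = 1 / 2) :
    ∫ x, spin (x i) ∂(Q : Measure (Fin n → Bool)) = 0 := by
  rw [real_eq_sum_mass] at h
  rw [integral_eq_sum_mass]
  have h1 := sum_mass Q
  calc ∑ x, mass Q x * spin (x i)
      = 2 * ∑ x, mass Q x * (if x ∈ {x : Fin n → Bool | x i = true} then 1 else 0)
        - ∑ x, mass Q x := by
        rw [Finset.mul_sum, ← Finset.sum_sub_distrib]
        refine Finset.sum_congr rfl fun x _ => ?_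
        simp only [Set.mem_ofPred_eq]
        rcases Bool.eq_false_or_eq_true (x i) with hx | hx <;> simp [hx]
        ring
    _ = 0 := by rw [h, h1]; norm_num

lemma Balanced.of_mem_kWise {k : ℕ} {Q : ProbabilityMeasure (Fin n → Bool)}
    (hQ : Q ∈ kWise n k (1 / 2)) : Balanced k (mass Q) := by
  intro T hT hk
  rw [← integral_eq_sum_mass]
  have hind := (hQ.1 T hk).comp (fun _ => spin) (fun _ => measurable_of_finite _)
  have := hind.integral_fun_prod_eq_prod_integral
    (fun i => (measurable_of_finite _).aestronglyMeasurable)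
  simp only [Function.comp_apply] at this
  calc ∫ x, walsh T x ∂(Q : Measure (Fin n → Bool))
      = ∫ x, ∏ i : T, spin (x i) ∂(Q : Measure (Fin n → Bool)) := by
        congr 1; ext x; rw [walsh, Finset.prod_coe_sort T fun i => spin (x i)]
    _ = _ := this
    _ = 0 := by
        obtain ⟨i, hi⟩ := hT
        exact Finset.prod_eq_zero (Finset.mem_univ ⟨i, hi⟩) (integral_spin (hQ.2 i))

/-- Under a balanced probability vector every set of at most `k` bits is uniform. The indicator of
the event that the bits in `T` agree with `y` is `∏_{i ∈ T} (1 + σ(y_i) σ(x_i)) / 2`, whose Walsh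
expansion has only the constant term left after taking expectations. -/
lemma Balanced.cylinder {k : ℕ} {Q : ProbabilityMeasure (Fin n → Bool)}
    (h : Balanced k (mass Q)) {T : Finset (Fin n)} (hT : T.card ≤ k) (y : Fin n → Bool) :
    (Q : Measure (Fin n → Bool)).real {x | ∀ i ∈ T, x i = y i} = (1 / 2) ^ T.card := by
  classical
  rw [real_eq_sum_mass]
  have key (x : Fin n → Bool) :
      (if x ∈ {x : Fin n → Bool | ∀ i ∈ T, x i = y i} then (1 : ℝ) else 0)
        = (1 / 2) ^ T.card * ∑ U ∈ T.powerset, walsh U y * walsh U x := by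
    have h1 : ∑ U ∈ T.powerset, walsh U y * walsh U x
        = ∏ i ∈ T, (1 + spin (y i) * spin (x i)) := by
      rw [Finset.prod_one_add]
      simp [walsh, Finset.prod_mul_distrib]
    rw [h1, ← Finset.prod_const, ← Finset.prod_mul_distrib]
    split_ifs with hx
    · symm
      refine Finset.prod_eq_one fun i hi => ?_
      rw [hx i hi, spin_mul_self]; norm_num
    · simp only [Set.mem_ofPred_eq, not_forall] at hx
      obtain ⟨i, hi, hne⟩ := hx
      symm
      refine Finset.prod_eq_zero hi ?_
      revert hne
      cases x i <;> cases y i <;> simp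
  simp_rw [key, Finset.mul_sum]
  rw [Finset.sum_comm, Finset.sum_eq_single ∅]
  · simp only [walsh_empty, mul_one]
    rw [← Finset.sum_mul, sum_mass, one_mul]
  · intro U hU hne
    have := h U (Finset.nonempty_iff_ne_empty.2 hne)
      ((Finset.card_le_card (Finset.mem_powerset.1 hU)).trans hT)
    calc ∑ x, mass Q x * ((1 / 2) ^ T.card * (walsh U y * walsh U x))
        = (1 / 2) ^ T.card * walsh U y * ∑ x, mass Q x * walsh U x := by
          rw [Finset.mul_sum]; exact Finset.sum_congr rfl fun x _ => by ring
      _ = 0 := by rw [this, mul_zero]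
  · intro h; simp at h

lemma Balanced.mem_kWise {k : ℕ} (hk : 1 ≤ k) {Q : ProbabilityMeasure (Fin n → Bool)}
    (h : Balanced k (mass Q)) : Q ∈ kWise n k (1 / 2) := by
  classical
  have hone (i : Fin n) (b : Bool) :
      (Q : Measure (Fin n → Bool)).real {x | x i = b} = 1 / 2 := by
    have := h.cylinder (T := {i}) (by simpa using hk) (fun _ => b)
    simpa using this
  refine ⟨fun T hT => ?_, fun i => hone i true⟩
  rw [iIndepFun_iff_map_fun_eq_pi_map fun i => (measurable_of_finite _).aemeasurable]
  refine Measure.ext_of_singleton fun y => ?_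
  rw [Measure.pi_singleton, Measure.map_apply (measurable_of_finite _) (.singleton y)]
  have h1 (i : T) : (Measure.map (fun x : Fin n → Bool => x i) (Q : Measure (Fin n → Bool))) {y i}
      = ENNReal.ofReal (1 / 2) := by
    rw [Measure.map_apply (measurable_of_finite _) (.singleton _), ← hone i (y i),
      ofReal_measureReal]
    rfl
  rw [Finset.prod_congr rfl fun i _ => h1 i, Finset.prod_const, ← ENNReal.ofReal_pow (by norm_num)]
  have h2 := h.cylinder hT (fun i => if hi : i ∈ T then y ⟨i, hi⟩ else true)
  have h3 : (fun (ω : Fin n → Bool) (i : T) => ω i) ⁻¹' {y}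
      = {x | ∀ i ∈ T, x i = if hi : i ∈ T then y ⟨i, hi⟩ else true} := by
    ext x
    simp only [Set.mem_preimage, Set.mem_singleton_iff, Set.mem_ofPred_eq, funext_iff,
      Subtype.forall]
    exact forall₂_congr fun i hi => by simp [hi]
  rw [h3, ← ofReal_measureReal, h2]
  simp

lemma mem_kWise_iff {k : ℕ} (hk : 1 ≤ k) {Q : ProbabilityMeasure (Fin n → Bool)} :
    Q ∈ kWise n k (1 / 2) ↔ Balanced k (mass Q) :=
  ⟨Balanced.of_mem_kWise, Balanced.mem_kWise hk⟩

/-! ### The deviation of majority and its maximum -/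

lemma spinSum_eq (x : Fin n → Bool) :
    spinSum x = 2 * ((Finset.univ.filter fun i => x i = true).card : ℝ) - n := by
  have h (i : Fin n) : spin (x i) = 2 * (if x i = true then 1 else 0) - 1 := by
    cases x i <;> norm_num
  simp only [spinSum, h]
  rw [Finset.sum_sub_distrib, ← Finset.mul_sum]
  simp

/-- For an odd number of bits the sign sum is an odd integer; in particular it is not zero. -/
lemma exists_spinSum_eq (hn : Odd n) (x : Fin n → Bool) : ∃ m : ℤ, spinSum x = 2 * m + 1 := by
  obtain ⟨j, rfl⟩ := hn
  refine ⟨(Finset.univ.filter fun i => x i = true).card - j - 1, ?_⟩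
  rw [spinSum_eq]; push_cast; ring

lemma spinSum_ne_zero (hn : Odd n) (x : Fin n → Bool) : spinSum x ≠ 0 := by
  obtain ⟨m, hm⟩ := exists_spinSum_eq hn x
  rw [hm]
  intro h
  have : 2 * m + 1 = 0 := by exact_mod_cast h
  omega

lemma maj_indicator (hn : Odd n) (x : Fin n → Bool) :
    (if x ∈ {x : Fin n → Bool | maj x = true} then (1 : ℝ) else 0)
      = (1 + SignType.sign (spinSum x)) / 2 := by
  have h0 := spinSum_ne_zero hn x
  have hiff : maj x = true ↔ 0 < spinSum x := by
    rw [spinSum_eq, maj, decide_eq_true_iff, sub_pos]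
    norm_cast
  simp only [Set.mem_ofPred_eq, hiff]
  rcases lt_or_gt_of_ne h0 with h | h
  · simp [h, h.not_gt]
  · simp [h]

lemma majDev_eq (hn : Odd n) (Q : ProbabilityMeasure (Fin n → Bool)) :
    majDev Q = |∑ x, mass Q x * (SignType.sign (spinSum x) : ℝ)| / 2 := by
  have h2 : |(2 : ℝ)| = 2 := abs_two
  rw [majDev, real_eq_sum_mass, ← h2, ← abs_div, h2]
  congr 1
  simp_rw [maj_indicator hn]
  have : ∀ x, mass Q x * ((1 + (SignType.sign (spinSum x) : ℝ)) / 2)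
      = (mass Q x + mass Q x * (SignType.sign (spinSum x) : ℝ)) / 2 := fun x => by ring
  simp_rw [this]
  rw [← Finset.sum_div, Finset.sum_add_distrib, sum_mass]
  ring

lemma balanced_const (k : ℕ) (c : ℝ) : Balanced k (fun _ : Fin n → Bool => c) := fun T hT _ => by
  rw [← Finset.mul_sum, sum_walsh hT, mul_zero]

lemma card_cube : (∑ _x : Fin n → Bool, (1 : ℝ)) = 2 ^ n := by simp

/-- The maximum is attained: in terms of point masses the admissible distributions form a compact
slice of the simplex, on which the deviation is continuous. -/
lemma exists_isGreatest (hn : Odd n) {k : ℕ} (hk : 1 ≤ k) :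
    ∃ M : ℝ, IsGreatest (majDev '' kWise n k (1 / 2)) M := by
  set D : Set ((Fin n → Bool) → ℝ) := stdSimplex ℝ _ ∩ {w | Balanced k w} with hD
  have hclosed : IsClosed {w : (Fin n → Bool) → ℝ | Balanced k w} := by
    simp only [Balanced, Set.ofPred_forall]
    refine isClosed_iInter fun T => isClosed_iInter fun _ => isClosed_iInter fun _ => ?_
    exact isClosed_eq (by fun_prop) continuous_const
  have hcomp : IsCompact D := (isCompact_stdSimplex ℝ _).inter_right hclosed
  have hne : D.Nonempty := by
    refine ⟨fun _ => 1 / 2 ^ n, ⟨fun _ => by positivity, ?_⟩, balanced_const k _⟩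
    simp
  have hcont : Continuous fun w : (Fin n → Bool) → ℝ =>
      |∑ x, w x * (SignType.sign (spinSum x) : ℝ)| / 2 := by fun_prop
  obtain ⟨w, hw, hmax⟩ := hcomp.exists_isMaxOn hne hcont.continuousOn
  obtain ⟨Q, hQ⟩ := exists_mass_eq hw.1.1 hw.1.2
  refine ⟨majDev Q, ⟨Q, (mem_kWise_iff hk).2 (hQ ▸ hw.2), rfl⟩, ?_⟩
  rintro _ ⟨R, hR, rfl⟩
  have := hmax (a := mass R) ⟨⟨mass_nonneg R, sum_mass R⟩, (mem_kWise_iff hk).1 hR⟩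
  rw [majDev_eq hn, majDev_eq hn, hQ]
  exact this

/-! ### Polynomials in the sign sum -/

/-- The functions on the cube that are polynomials of degree at most `d` in the bits. -/
def lowDegree (n d : ℕ) : Submodule ℝ ((Fin n → Bool) → ℝ) :=
  Submodule.span ℝ {f | ∃ T : Finset (Fin n), T.card ≤ d ∧ f = walsh T}

lemma lowDegree_mono {d e : ℕ} (h : d ≤ e) : lowDegree n d ≤ lowDegree n e :=
  Submodule.span_mono fun _ ⟨T, hT, hf⟩ => ⟨T, hT.trans h, hf⟩

lemma spin_mul_mem_lowDegree {d : ℕ} {f : (Fin n → Bool) → ℝ} (hf : f ∈ lowDegree n d)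
    (i : Fin n) : (fun x => spin (x i) * f x) ∈ lowDegree n (d + 1) := by
  induction hf using Submodule.span_induction with
  | mem f hf =>
    obtain ⟨T, hT, rfl⟩ := hf
    refine Submodule.subset_span ⟨symmDiff {i} T, ?_, ?_⟩
    · have h1 : symmDiff {i} T ⊆ {i} ∪ T := by
        intro j; simp only [mem_symmDiff, mem_union]; tauto
      have := (card_le_card h1).trans (card_union_le _ _)
      rw [card_singleton] at this
      omega
    · ext x
      rw [← walsh_mul_walsh]
      simp [walsh]
  | zero => simp only [Pi.zero_apply, mul_zero]; exact Submodule.zero_mem _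
  | add f g _ _ hf hg =>
    simp only [Pi.add_apply, mul_add]
    exact Submodule.add_mem _ hf hg
  | smul c f _ hf =>
    have : (fun x => spin (x i) * (c • f) x) = c • fun x => spin (x i) * f x := by
      ext x; simp only [Pi.smul_apply, smul_eq_mul]; ring
    rw [this]
    exact Submodule.smul_mem _ _ hf

lemma spinSum_pow_mem_lowDegree (d : ℕ) :
    (fun x : Fin n → Bool => spinSum x ^ d) ∈ lowDegree n d := by
  induction d with
  | zero => exact Submodule.subset_span ⟨∅, by simp, by ext; simp⟩
  | succ d ih =>
    have : (fun x : Fin n → Bool => spinSum x ^ (d + 1))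
        = ∑ i, fun x => spin (x i) * spinSum x ^ d := by
      ext x
      rw [Finset.sum_apply, ← Finset.sum_mul, ← spinSum, pow_succ']
    rw [this]
    exact Submodule.sum_mem _ fun i _ => spin_mul_mem_lowDegree ih i

lemma eval_spinSum_mem_lowDegree {p : Polynomial ℝ} {d : ℕ} (hp : p.natDegree ≤ d) :
    (fun x : Fin n → Bool => p.eval (spinSum x)) ∈ lowDegree n d := by
  have : (fun x : Fin n → Bool => p.eval (spinSum x))
      = ∑ i ∈ range (p.natDegree + 1), p.coeff i • fun x => spinSum x ^ i := by
    ext x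
    rw [Polynomial.eval_eq_sum_range]
    simp
  rw [this]
  refine Submodule.sum_mem _ fun i hi => Submodule.smul_mem _ _ ?_
  exact lowDegree_mono (by have := mem_range.1 hi; omega) (spinSum_pow_mem_lowDegree i)

/-- A balanced probability vector gives functions of degree at most `k` their uniform mean. -/
lemma Balanced.sum_eq {k : ℕ} {w : (Fin n → Bool) → ℝ} (hw : Balanced k w) (h1 : ∑ x, w x = 1)
    {f : (Fin n → Bool) → ℝ} (hf : f ∈ lowDegree n k) :
    ∑ x, w x * f x = (∑ x, f x) / 2 ^ n := by
  induction hf using Submodule.span_induction with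
  | mem f hf =>
    obtain ⟨T, hT, rfl⟩ := hf
    rcases T.eq_empty_or_nonempty with rfl | hne
    · simp [h1]
    · rw [hw T hne hT, sum_walsh hne, zero_div]
  | zero => simp
  | add f g _ _ hf hg =>
    simp only [Pi.add_apply, mul_add, Finset.sum_add_distrib, hf, hg, add_div]
  | smul c f _ hf =>
    simp only [Pi.smul_apply, smul_eq_mul]
    rw [← Finset.mul_sum, mul_div_assoc, ← hf, Finset.mul_sum]
    exact Finset.sum_congr rfl fun x _ => by ring

lemma sum_odd_eq_zero {f : ℝ → ℝ} (hf : ∀ s, f (-s) = -f s) :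
    ∑ x : Fin n → Bool, f (spinSum x) = 0 := by
  have h := Equiv.sum_comp (Equiv.piCongrRight fun _ : Fin n => Equiv.boolNot)
    fun x => f (spinSum x)
  have h2 (x : Fin n → Bool) :
      spinSum ((Equiv.piCongrRight fun _ : Fin n => Equiv.boolNot) x) = -spinSum x := by
    simp [spinSum, spin_not]
  simp_rw [h2, hf, Finset.sum_neg_distrib] at h
  linarith

/-! ### Krawtchouk polynomials -/

/-- The elementary symmetric polynomial of degree `j` in the signs of the bits. -/
def elemSym (j : ℕ) (x : Fin n → Bool) : ℝ := ∑ T ∈ Finset.univ.powersetCard j, walsh T x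

lemma sum_elemSym_mul_elemSym (i j : ℕ) :
    ∑ x : Fin n → Bool, elemSym i x * elemSym j x = if i = j then 2 ^ n * (n.choose i : ℝ) else 0 := by
  simp_rw [elemSym, Finset.sum_mul_sum]
  rw [Finset.sum_comm]
  simp_rw [Finset.sum_comm (s := Finset.univ (α := Fin n → Bool)), sum_walsh_mul_walsh]
  split_ifs with h
  · subst h
    calc ∑ T ∈ univ.powersetCard i, ∑ U ∈ univ.powersetCard i,
          (if (T : Finset (Fin n)) = U then (2 : ℝ) ^ n else 0)
        = ∑ T ∈ (univ : Finset (Fin n)).powersetCard i, (2 : ℝ) ^ n :=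
          Finset.sum_congr rfl fun T hT => by rw [Finset.sum_ite_eq, if_pos hT]
      _ = 2 ^ n * (n.choose i : ℝ) := by simp [mul_comm]
  · refine Finset.sum_eq_zero fun T hT => Finset.sum_eq_zero fun U hU => if_neg ?_
    rintro rfl
    exact h ((mem_powersetCard.1 hT).2.symm.trans (mem_powersetCard.1 hU).2)

open Polynomial in
lemma coeff_prod_one_add (x : Fin n → Bool) (j : ℕ) :
    (∏ i, (1 + C (spin (x i)) * X : ℝ[X])).coeff j = elemSym j x := by
  rw [Finset.prod_one_add]
  simp_rw [Finset.prod_mul_distrib, Finset.prod_const, ← map_prod, finsetSum_coeff,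
    coeff_C_mul_X_pow]
  rw [← Finset.sum_filter, elemSym]
  refine Finset.sum_congr ?_ fun _ _ => rfl
  ext T; simp [mem_powersetCard, eq_comm]

open Polynomial in
/-- The logarithmic derivative of the generating function `∏ (1 + σ_i X)`, cleared of
denominators. -/
lemma derivative_prod_one_add (s : Finset (Fin n)) (x : Fin n → Bool) :
    (1 - X ^ 2) * derivative (∏ i ∈ s, (1 + C (spin (x i)) * X : ℝ[X]))
      = (C (∑ i ∈ s, spin (x i)) - C (s.card : ℝ) * X) *
          ∏ i ∈ s, (1 + C (spin (x i)) * X : ℝ[X]) := by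
  classical
  induction s using Finset.induction_on with
  | empty => simp
  | insert a s ha ih =>
    rw [prod_insert ha, sum_insert ha, card_insert_of_notMem ha, derivative_mul]
    have h2 : (C (spin (x a)) : ℝ[X]) * C (spin (x a)) = 1 := by
      rw [← C_mul, spin_mul_self, C_1]
    simp only [derivative_one, derivative_mul, derivative_C, derivative_X, zero_mul,
      zero_add, mul_one, map_add, Nat.cast_add, Nat.cast_one, C_1]
    set P := ∏ i ∈ s, (1 + C (spin (x i)) * X : ℝ[X])
    set c : ℝ[X] := C (spin (x a))
    linear_combination (1 + c * X) * ih - X * P * h2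

lemma elemSym_zero (x : Fin n → Bool) : elemSym 0 x = 1 := by simp [elemSym]

lemma elemSym_one (x : Fin n → Bool) : elemSym 1 x = spinSum x := by
  rw [← coeff_prod_one_add]
  have h := congrArg (Polynomial.coeff · 0) (derivative_prod_one_add Finset.univ x)
  simp [Polynomial.mul_coeff_zero, Polynomial.coeff_derivative, Polynomial.coeff_zero_prod] at h
  rw [h, spinSum]

/-- The three-term recurrence of the Krawtchouk polynomials. -/
lemma elemSym_recurrence (x : Fin n → Bool) (j : ℕ) :
    (j + 2) * elemSym (j + 2) x = spinSum x * elemSym (j + 1) x - (n - j) * elemSym j x := by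
  have h := congrArg (Polynomial.coeff · (j + 1)) (derivative_prod_one_add Finset.univ x)
  simp only [sub_mul, one_mul, Polynomial.coeff_sub, mul_assoc, Polynomial.coeff_C_mul,
    Polynomial.coeff_X_mul, Polynomial.coeff_derivative, coeff_prod_one_add, card_univ,
    Fintype.card_fin] at h
  rw [← spinSum] at h
  rcases j with _ | j
  · have : (Polynomial.X ^ 2 * Polynomial.derivative
        (∏ i, (1 + Polynomial.C (spin (x i)) * Polynomial.X))).coeff (0 + 1) = 0 := by
      rw [mul_comm, Polynomial.coeff_mul_X_pow']; simp
    rw [this] at h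
    push_cast at h ⊢
    linarith
  · have : (Polynomial.X ^ 2 * Polynomial.derivative
        (∏ i, (1 + Polynomial.C (spin (x i)) * Polynomial.X))).coeff (j + 1 + 1)
        = elemSym (j + 1) x * (j + 1) := by
      rw [mul_comm, Polynomial.coeff_mul_X_pow, Polynomial.coeff_derivative, coeff_prod_one_add]
    rw [this] at h
    push_cast at h ⊢
    linarith

/-! ### Normalized central binomial coefficients -/

/-- The normalized central binomial coefficient `C(2i, i) / 4^i`. -/
noncomputable def wallis (i : ℕ) : ℝ := i.centralBinom / 4 ^ i

lemma wallis_zero : wallis 0 = 1 := by simp [wallis]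

lemma wallis_pos (i : ℕ) : 0 < wallis i := by
  have := Nat.centralBinom_pos i
  unfold wallis; positivity

lemma wallis_succ (i : ℕ) : (2 * i + 2) * wallis (i + 1) = (2 * i + 1) * wallis i := by
  have h : ((i : ℝ) + 1) * (i + 1).centralBinom = 2 * (2 * i + 1) * i.centralBinom := by
    exact_mod_cast Nat.succ_mul_centralBinom_succ i
  rw [wallis, wallis, pow_succ]
  field_simp
  linear_combination 2 * h

lemma wallis_succ_le (i : ℕ) : wallis (i + 1) ≤ wallis i := by
  have h := wallis_succ i
  have := wallis_pos i
  nlinarith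

/-- `C(2i, i) / 4^i ≥ 1 / (2 √i)`, in squared form. -/
lemma one_le_wallis_sq {i : ℕ} (hi : 1 ≤ i) : 1 ≤ 4 * i * wallis i ^ 2 := by
  induction i, hi using Nat.le_induction with
  | base =>
    have := wallis_succ 0
    rw [wallis_zero] at this
    norm_num at this ⊢
    nlinarith
  | succ i hi ih =>
    have h := wallis_succ i
    have h2 : ((2 * i + 2) * wallis (i + 1)) ^ 2 = ((2 * i + 1) * wallis i) ^ 2 := by rw [h]
    have hi' : (1 : ℝ) ≤ i := by exact_mod_cast hi
    push_cast
    have h3 : (i : ℝ) * (4 * (i + 1) * wallis (i + 1) ^ 2 * (i + 1))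
        = i * ((2 * i + 1) * wallis i) ^ 2 := by rw [← h2]; ring
    have h4 : (i : ℝ) * (i + 1) ≤ i * (4 * (i + 1) * wallis (i + 1) ^ 2 * (i + 1)) := by
      rw [h3]
      nlinarith [mul_le_mul_of_nonneg_left ih (sq_nonneg (2 * (i : ℝ) + 1))]
    have h5 : (0 : ℝ) < i * (i + 1) := by positivity
    have h6 : (i : ℝ) * (i + 1) * 1 ≤ i * (i + 1) * (4 * (i + 1) * wallis (i + 1) ^ 2) := by
      linarith
    exact le_of_mul_le_mul_left h6 h5

lemma sum_wallis (l : ℕ) : ∑ i ∈ range (l + 1), wallis i = (2 * l + 1) * wallis l := by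
  induction l with
  | zero => simp
  | succ l ih =>
    rw [Finset.sum_range_succ, ih, ← wallis_succ]
    push_cast; ring

/-! ### The Christoffel kernel at the origin -/

section Krawtchouk

open Polynomial

/-- The pair `(A_i, B_i)` with `K_{2i}(s) = A_i(s^2)` and `K_{2i+1}(s) = s B_i(s^2)`, where `K_j` is
the Krawtchouk polynomial, centred so that its argument is the sign sum. -/
noncomputable def krawPair (n : ℕ) : ℕ → ℝ[X] × ℝ[X]
  | 0 => (1, 1)
  | i + 1 =>
    let A := C (1 / (2 * i + 2 : ℝ)) *
      (X * (krawPair n i).2 - C ((n : ℝ) - 2 * i) * (krawPair n i).1)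
    (A, C (1 / (2 * i + 3 : ℝ)) * (A - C ((n : ℝ) - 2 * i - 1) * (krawPair n i).2))

lemma krawPair_succ_fst_eval (i : ℕ) (t : ℝ) :
    (2 * i + 2) * (krawPair n (i + 1)).1.eval t
      = t * (krawPair n i).2.eval t - (n - 2 * i) * (krawPair n i).1.eval t := by
  simp only [krawPair, eval_mul, eval_sub, eval_C, eval_X]
  field_simp

lemma krawPair_succ_snd_eval (i : ℕ) (t : ℝ) :
    (2 * i + 3) * (krawPair n (i + 1)).2.eval t
      = (krawPair n (i + 1)).1.eval t - (n - 2 * i - 1) * (krawPair n i).2.eval t := by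
  simp only [krawPair, eval_mul, eval_sub, eval_C, eval_X]
  field_simp

lemma krawPair_natDegree (i : ℕ) :
    (krawPair n i).1.natDegree ≤ i ∧ (krawPair n i).2.natDegree ≤ i := by
  induction i with
  | zero => simp [krawPair]
  | succ i ih =>
    have h1 : (krawPair n (i + 1)).1.natDegree ≤ i + 1 := by
      refine (natDegree_C_mul_le _ _).trans ((natDegree_sub_le _ _).trans (max_le ?_ ?_))
      · refine natDegree_mul_le.trans ?_
        rw [natDegree_X]; omega
      · exact (natDegree_C_mul_le _ _).trans (by omega)
    refine ⟨h1, ?_⟩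
    refine (natDegree_C_mul_le _ _).trans ((natDegree_sub_le _ _).trans (max_le h1 ?_))
    exact (natDegree_C_mul_le _ _).trans (by omega)

lemma elemSym_eq_krawPair (x : Fin n → Bool) (i : ℕ) :
    elemSym (2 * i) x = (krawPair n i).1.eval (spinSum x ^ 2) ∧
      elemSym (2 * i + 1) x = spinSum x * (krawPair n i).2.eval (spinSum x ^ 2) := by
  induction i with
  | zero => simp [krawPair, elemSym_zero, elemSym_one]
  | succ i ih =>
    have h1 := elemSym_recurrence x (2 * i)
    have h2 := elemSym_recurrence x (2 * i + 1)
    have h3 := krawPair_succ_fst_eval (n := n) i (spinSum x ^ 2)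
    have h4 := krawPair_succ_snd_eval (n := n) i (spinSum x ^ 2)
    rw [ih.1, ih.2] at h1
    rw [ih.2] at h2
    push_cast at h1 h2
    have h5 : elemSym (2 * (i + 1)) x = (krawPair n (i + 1)).1.eval (spinSum x ^ 2) := by
      have : (0 : ℝ) < 2 * i + 2 := by positivity
      refine mul_left_cancel₀ this.ne' ?_
      rw [mul_add, mul_one]
      linear_combination h1 - h3
    refine ⟨h5, ?_⟩
    rw [mul_add, mul_one] at h5 ⊢
    rw [h5] at h2
    have : (0 : ℝ) < 2 * i + 3 := by positivity
    refine mul_left_cancel₀ this.ne' ?_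
    linear_combination h2 - spinSum x * h4

/-- On the imaginary axis the recurrence of the Krawtchouk polynomials has positive coefficients, so
that their absolute values grow away from the origin. -/
lemma krawPair_neg_mono {s : ℝ} (hs : 0 ≤ s) {i : ℕ} (hi : 2 * i ≤ n) :
    0 ≤ (-1) ^ i * (krawPair n i).1.eval 0 ∧
    (-1) ^ i * (krawPair n i).1.eval 0 ≤ (-1) ^ i * (krawPair n i).1.eval (-s) ∧
    0 ≤ (-1) ^ i * (krawPair n i).2.eval (-s) := by
  induction i with
  | zero => simp [krawPair]
  | succ i ih =>
    obtain ⟨h1, h2, h3⟩ := ih (by omega)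
    have hn : (0 : ℝ) ≤ n - 2 * i - 1 := by
      have : (2 * (i + 1 : ℕ) : ℝ) ≤ n := by exact_mod_cast hi
      push_cast at this; linarith
    have p2 : (0 : ℝ) < 2 * i + 2 := by positivity
    have p3 : (0 : ℝ) < 2 * i + 3 := by positivity
    have e0 := krawPair_succ_fst_eval (n := n) i 0
    have e1 := krawPair_succ_fst_eval (n := n) i (-s)
    have e2 := krawPair_succ_snd_eval (n := n) i (-s)
    have hn' : (0 : ℝ) ≤ n - 2 * i := by linarith
    simp only [pow_succ]
    set u : ℝ := (-1) ^ i
    have g0 : 0 ≤ u * -1 * (krawPair n (i + 1)).1.eval 0 := by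
      refine nonneg_of_mul_nonneg_right (b := _) ?_ p2
      have := mul_nonneg hn' h1
      linear_combination this + u * e0
    have g1 : u * -1 * (krawPair n (i + 1)).1.eval 0
        ≤ u * -1 * (krawPair n (i + 1)).1.eval (-s) := by
      refine le_of_mul_le_mul_left ?_ p2
      have a1 := mul_le_mul_of_nonneg_left h2 hn'
      have a2 := mul_nonneg hs h3
      linear_combination a1 + a2 + u * e1 - u * e0
    refine ⟨g0, g1, ?_⟩
    refine nonneg_of_mul_nonneg_right (b := _) ?_ p3
    have := mul_nonneg hn h3
    linear_combination this + u * e2 + g0 + g1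

lemma wallis_mul_choose_le {i : ℕ} (hi : 2 * i ≤ n) :
    wallis i * n.choose (2 * i) ≤ (krawPair n i).1.eval 0 ^ 2 := by
  induction i with
  | zero => simp [krawPair, wallis_zero]
  | succ i ih =>
    have ih := ih (by omega)
    have hn : (0 : ℝ) ≤ n - 2 * i - 1 := by
      have : (2 * (i + 1 : ℕ) : ℝ) ≤ n := by exact_mod_cast hi
      push_cast at this; linarith
    have e0 := krawPair_succ_fst_eval (n := n) i 0
    rw [zero_mul, zero_sub] at e0
    have c1 : (n.choose (2 * i + 1) : ℝ) * (2 * i + 1) = n.choose (2 * i) * (n - 2 * i) := by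
      have := Nat.choose_succ_right_eq n (2 * i)
      rw [← Nat.cast_inj (R := ℝ)] at this
      push_cast [Nat.cast_sub (show 2 * i ≤ n by omega)] at this
      exact this
    have c2 : (n.choose (2 * i + 2) : ℝ) * (2 * i + 2)
        = n.choose (2 * i + 1) * (n - 2 * i - 1) := by
      have := Nat.choose_succ_right_eq n (2 * i + 1)
      rw [← Nat.cast_inj (R := ℝ)] at this
      push_cast [Nat.cast_sub (show 2 * i + 1 ≤ n by omega)] at this
      linear_combination this
    have hw := wallis_succ i
    have hp := wallis_pos i
    have p2 : (0 : ℝ) < (2 * i + 2) ^ 2 := by positivity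
    rw [mul_add, mul_one]
    refine le_of_mul_le_mul_left ?_ p2
    set a := (krawPair n i).1.eval 0
    have r : ((2 * i + 2 : ℝ)) ^ 2 * (krawPair n (i + 1)).1.eval 0 ^ 2 = (n - 2 * i) ^ 2 * a ^ 2 := by
      rw [← mul_pow, e0]; ring
    have l : ((2 * i + 2 : ℝ)) ^ 2 * (wallis (i + 1) * n.choose (2 * i + 2))
        = (n - 2 * i) * (n - 2 * i - 1) * (wallis i * n.choose (2 * i)) := by
      calc _ = ((2 * i + 2) * wallis (i + 1)) * ((n.choose (2 * i + 2) : ℝ) * (2 * i + 2)) := by ring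
        _ = wallis i * (n - 2 * i - 1) * ((n.choose (2 * i + 1) : ℝ) * (2 * i + 1)) := by
          rw [hw, c2]; ring
        _ = _ := by rw [c1]; ring
    rw [r, l]
    have hc : 0 ≤ wallis i * (n.choose (2 * i) : ℝ) := by positivity
    calc _ ≤ ((n : ℝ) - 2 * i) ^ 2 * (wallis i * n.choose (2 * i)) := by
          refine mul_le_mul_of_nonneg_right ?_ hc
          nlinarith
      _ ≤ _ := mul_le_mul_of_nonneg_left ih (sq_nonneg _)

/-- The normalized Christoffel–Darboux kernel of the Krawtchouk polynomials at the origin, as a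
polynomial `P` in the square of the sign sum. The constant `L` makes its value at the origin equal to
`1`; on the negative half-line it is larger, while its second moment for independent bits is
`1 / L`. -/
lemma exists_christoffel {l : ℕ} (hl : 2 * l ≤ n) :
    ∃ P : ℝ[X], P.natDegree ≤ l ∧ (∀ s, 0 ≤ s → 1 ≤ P.eval (-s)) ∧
      (∑ x : Fin n → Bool, P.eval (spinSum x ^ 2) ^ 2) / 2 ^ n ≤ 1 / ((2 * l + 1) * wallis l) := by
  set a : ℕ → ℝ := fun i => (krawPair n i).1.eval 0 with ha
  set c : ℕ → ℝ := fun i => n.choose (2 * i) with hc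
  set L : ℝ := ∑ i ∈ range (l + 1), a i ^ 2 / c i with hL
  have cpos {i : ℕ} (hi : i ∈ range (l + 1)) : 0 < c i := by
    have : 2 * i ≤ n := by have := mem_range.1 hi; omega
    exact Nat.cast_pos.2 (Nat.choose_pos this)
  have hLge : (2 * l + 1) * wallis l ≤ L := by
    rw [← sum_wallis]
    refine Finset.sum_le_sum fun i hi => ?_
    rw [le_div_iff₀ (cpos hi)]
    exact wallis_mul_choose_le (by have := mem_range.1 hi; omega)
  have hW : 0 < (2 * l + 1) * wallis l := by have := wallis_pos l; positivity
  have hLpos : 0 < L := hW.trans_le hLge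
  have hsum : ∑ i ∈ range (l + 1), a i / (c i * L) * a i = 1 := by
    rw [← div_self hLpos.ne']
    calc ∑ i ∈ range (l + 1), a i / (c i * L) * a i
        = ∑ i ∈ range (l + 1), a i ^ 2 / c i / L := by
          refine Finset.sum_congr rfl fun i hi => ?_
          have := cpos hi
          field_simp
      _ = L / L := by rw [← Finset.sum_div]
  refine ⟨∑ i ∈ range (l + 1), C (a i / (c i * L)) * (krawPair n i).1, ?_, ?_, ?_⟩
  · refine natDegree_sum_le_of_forall_le _ _ fun i hi => ?_
    refine (natDegree_C_mul_le _ _).trans ((krawPair_natDegree i).1.trans ?_)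
    have := mem_range.1 hi; omega
  · intro s hs
    simp only [eval_finsetSum, eval_mul, eval_C]
    calc (1 : ℝ) = ∑ i ∈ range (l + 1), a i / (c i * L) * a i := hsum.symm
      _ ≤ _ := by
        refine Finset.sum_le_sum fun i hi => ?_
        obtain ⟨h1, h2, -⟩ := krawPair_neg_mono (n := n) hs (i := i)
          (by have := mem_range.1 hi; omega)
        have h3 := mul_le_mul_of_nonneg_left h2 h1
        have hu : ((-1 : ℝ) ^ i) * (-1) ^ i = 1 := by rw [← mul_pow]; simp
        have h4 : a i * a i ≤ a i * (krawPair n i).1.eval (-s) := by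
          simp only [ha]
          linear_combination h3 + ((krawPair n i).1.eval 0 * ((krawPair n i).1.eval (-s)
            - (krawPair n i).1.eval 0)) * hu
        have := cpos hi
        rw [div_mul_eq_mul_div, div_mul_eq_mul_div]
        gcongr
  · have h1 : ∑ x : Fin n → Bool,
        (∑ i ∈ range (l + 1), C (a i / (c i * L)) * (krawPair n i).1).eval (spinSum x ^ 2) ^ 2
        = 2 ^ n * (1 / L) := by
      calc _ = ∑ x : Fin n → Bool, ∑ i ∈ range (l + 1), ∑ j ∈ range (l + 1),
            a i / (c i * L) * (a j / (c j * L)) * (elemSym (2 * i) x * elemSym (2 * j) x) := by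
            refine Finset.sum_congr rfl fun x _ => ?_
            simp only [eval_finsetSum, eval_mul, eval_C]
            rw [sq, Finset.sum_mul_sum]
            refine Finset.sum_congr rfl fun i _ => Finset.sum_congr rfl fun j _ => ?_
            rw [(elemSym_eq_krawPair x i).1, (elemSym_eq_krawPair x j).1]; ring
        _ = ∑ i ∈ range (l + 1), ∑ j ∈ range (l + 1),
            a i / (c i * L) * (a j / (c j * L)) * (if i = j then 2 ^ n * c i else 0) := by
            rw [Finset.sum_comm]
            refine Finset.sum_congr rfl fun i _ => ?_
            rw [Finset.sum_comm]
            refine Finset.sum_congr rfl fun j _ => ?_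
            rw [← Finset.mul_sum, sum_elemSym_mul_elemSym]
            simp [hc]
        _ = ∑ i ∈ range (l + 1), 2 ^ n * (a i ^ 2 / c i) / L ^ 2 := by
            refine Finset.sum_congr rfl fun i hi => ?_
            simp only [mul_ite, mul_zero]
            rw [Finset.sum_ite_eq, if_pos hi]
            have := cpos hi
            field_simp
        _ = 2 ^ n * (1 / L) := by
            rw [← Finset.sum_div, ← Finset.mul_sum, ← hL]
            field_simp
    rw [h1, mul_div_cancel_left₀ _ (by positivity)]
    exact one_div_le_one_div_of_le hW hLge

end Krawtchouk

/-! ### The upper bound -/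

lemma integrableOn_poisson {s : ℝ} (hs : s ≠ 0) :
    IntegrableOn (fun y : ℝ => s / (y ^ 2 + s ^ 2)) (Set.Ioi 0) := by
  have h := (integrable_inv_one_add_sq.comp_mul_left' (inv_ne_zero hs)).const_mul s⁻¹
  refine (h.congr (.of_forall fun y => ?_)).integrableOn
  have : (0 : ℝ) < y ^ 2 + s ^ 2 := by positivity
  have : (0 : ℝ) < s ^ 2 + y ^ 2 := by positivity
  field_simp
  ring

lemma integral_poisson {s : ℝ} (hs : s ≠ 0) :
    ∫ y in Set.Ioi (0 : ℝ), s / (y ^ 2 + s ^ 2) = SignType.sign s * (Real.pi / 2) := by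
  have key {t : ℝ} (ht : 0 < t) :
      ∫ y in Set.Ioi (0 : ℝ), t / (y ^ 2 + t ^ 2) = Real.pi / 2 := by
    have h := integral_comp_mul_left_Ioi (fun y : ℝ => (1 + y ^ 2)⁻¹) 0 (inv_pos.2 ht)
    rw [mul_zero, integral_Ioi_inv_one_add_sq, Real.arctan_zero, sub_zero, inv_inv,
      smul_eq_mul] at h
    have h2 : ∀ y : ℝ, t / (y ^ 2 + t ^ 2) = t⁻¹ * (1 + (t⁻¹ * y) ^ 2)⁻¹ := fun y => by
      have : (0 : ℝ) < y ^ 2 + t ^ 2 := by positivity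
      have : (0 : ℝ) < t ^ 2 + y ^ 2 := by positivity
      field_simp
      ring
    simp_rw [h2]
    rw [integral_const_mul, h]
    field_simp
  rcases lt_or_gt_of_ne hs with h | h
  · have := key (neg_pos.2 h)
    simp_rw [neg_sq, neg_div, integral_neg] at this
    simp only [sign_neg h, SignType.coe_neg_one]
    linarith
  · simp [sign_pos h, key h]

open Polynomial in
/-- For each `y` the function `s ↦ s (Ω(-y²) - Ω(s²)) / (y² + s²)` with `Ω = P²` is an odd
polynomial of degree at most `k`, and therefore has mean zero. -/
lemma Balanced.abs_sum_poisson_le {k l : ℕ} (hn : Odd n) (hk : 1 ≤ k) (hl : 4 * l ≤ k)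
    {w : (Fin n → Bool) → ℝ} (hw : Balanced k w) (hw0 : ∀ x, 0 ≤ w x) (hw1 : ∑ x, w x = 1)
    {P : ℝ[X]} (hdeg : P.natDegree ≤ l) (hP : ∀ s, 0 ≤ s → 1 ≤ P.eval (-s)) (y : ℝ) :
    |∑ x, w x * (spinSum x / (y ^ 2 + spinSum x ^ 2))|
      ≤ ∑ x, w x * P.eval (spinSum x ^ 2) ^ 2 *
          |spinSum x / (y ^ 2 + spinSum x ^ 2)| := by
  set B : ℝ := (P ^ 2).eval (-y ^ 2) with hB
  have hB1 : 1 ≤ B := by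
    rw [hB, eval_pow]
    exact one_le_pow₀ (hP (y ^ 2) (sq_nonneg y))
  set q : ℝ[X] := P ^ 2 /ₘ (X - C (-y ^ 2)) with hq
  have hdiv : (X - C (-y ^ 2)) * q + C B = P ^ 2 := by
    have := modByMonic_add_div (P ^ 2) (X - C (-y ^ 2))
    rw [modByMonic_X_sub_C_eq_C_eval] at this
    rw [← this, add_comm]
  have hqdeg : (X * q.comp (X ^ 2)).natDegree ≤ k := by
    have h1 : q.natDegree ≤ 2 * l - 1 := by
      rw [hq, natDegree_divByMonic _ (monic_X_sub_C _), natDegree_X_sub_C]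
      have : (P ^ 2).natDegree ≤ 2 * P.natDegree := natDegree_pow_le
      omega
    have h2 : (q.comp (X ^ 2)).natDegree ≤ q.natDegree * 2 := by
      rw [natDegree_comp, natDegree_X_pow]
    have h3 : (X * q.comp (X ^ 2)).natDegree ≤ 1 + (q.comp (X ^ 2)).natDegree := by
      refine natDegree_mul_le.trans ?_
      rw [natDegree_X]
    omega
  have hzero : ∑ x, w x * (spinSum x * q.eval (spinSum x ^ 2)) = 0 := by
    have h1 := hw.sum_eq hw1 (eval_spinSum_mem_lowDegree (n := n) hqdeg)
    have h2 := sum_odd_eq_zero (n := n) (f := fun s => s * q.eval (s ^ 2)) fun s => by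
      rw [neg_sq]; ring
    simp only [eval_mul, eval_X, eval_comp, eval_pow] at h1
    rw [h1, h2, zero_div]
  have hsplit : B * ∑ x, w x * (spinSum x / (y ^ 2 + spinSum x ^ 2))
      = ∑ x, w x * P.eval (spinSum x ^ 2) ^ 2 * (spinSum x / (y ^ 2 + spinSum x ^ 2)) := by
    rw [← sub_eq_zero, ← neg_eq_zero, ← hzero, Finset.mul_sum, ← Finset.sum_sub_distrib,
      ← Finset.sum_neg_distrib]
    refine Finset.sum_congr rfl fun x _ => ?_
    have h0 := spinSum_ne_zero hn x
    have hd := congrArg (Polynomial.eval (spinSum x ^ 2)) hdiv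
    simp only [eval_add, eval_mul, eval_sub, eval_X, eval_C, eval_pow] at hd
    have : (0 : ℝ) < y ^ 2 + spinSum x ^ 2 := by positivity
    field_simp
    linear_combination (-1 : ℝ) * w x * hd
  calc |∑ x, w x * (spinSum x / (y ^ 2 + spinSum x ^ 2))|
      ≤ B * |∑ x, w x * (spinSum x / (y ^ 2 + spinSum x ^ 2))| :=
        le_mul_of_one_le_left (abs_nonneg _) hB1
    _ = |B * ∑ x, w x * (spinSum x / (y ^ 2 + spinSum x ^ 2))| := by
        rw [abs_mul B, abs_of_pos (zero_lt_one.trans_le hB1)]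
    _ ≤ _ := by
        rw [hsplit]
        refine (Finset.abs_sum_le_sum_abs _ _).trans_eq (Finset.sum_congr rfl fun x _ => ?_)
        rw [abs_mul, abs_of_nonneg (mul_nonneg (hw0 x) (sq_nonneg _))]

open Polynomial in
/-- Integrating the bound for `s / (y² + s²)` over `y > 0` turns it into one for the sign of `s`. -/
lemma Balanced.abs_sum_sign_le {k l : ℕ} (hn : Odd n) (hk : 1 ≤ k) (hl : 4 * l ≤ k)
    {w : (Fin n → Bool) → ℝ} (hw : Balanced k w) (hw0 : ∀ x, 0 ≤ w x) (hw1 : ∑ x, w x = 1)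
    {P : ℝ[X]} (hdeg : P.natDegree ≤ l) (hP : ∀ s, 0 ≤ s → 1 ≤ P.eval (-s)) :
    |∑ x, w x * (SignType.sign (spinSum x) : ℝ)|
      ≤ (∑ x : Fin n → Bool, P.eval (spinSum x ^ 2) ^ 2) / 2 ^ n := by
  have hpi : 0 < Real.pi / 2 := by positivity
  have hint (x : Fin n → Bool) := integrableOn_poisson (spinSum_ne_zero hn x)
  have habs (x : Fin n → Bool) :
      ∫ y in Set.Ioi (0 : ℝ), |spinSum x / (y ^ 2 + spinSum x ^ 2)| = Real.pi / 2 := by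
    have h0 := abs_ne_zero.2 (spinSum_ne_zero hn x)
    have := integral_poisson h0
    rw [sign_pos (abs_pos.2 (spinSum_ne_zero hn x))] at this
    simp only [SignType.coe_one, one_mul, sq_abs] at this
    rw [← this]
    congr 1; ext y
    rw [abs_div, abs_of_nonneg (a := y ^ 2 + spinSum x ^ 2) (by positivity)]
  have hL : ∫ y in Set.Ioi (0 : ℝ), ∑ x, w x * (spinSum x / (y ^ 2 + spinSum x ^ 2))
      = (∑ x, w x * (SignType.sign (spinSum x) : ℝ)) * (Real.pi / 2) := by
    rw [integral_finsetSum _ fun x _ => (hint x).const_mul _, Finset.sum_mul]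
    refine Finset.sum_congr rfl fun x _ => ?_
    rw [integral_const_mul, integral_poisson (spinSum_ne_zero hn x), mul_assoc]
  have hR : ∫ y in Set.Ioi (0 : ℝ), ∑ x, w x * P.eval (spinSum x ^ 2) ^ 2 *
        |spinSum x / (y ^ 2 + spinSum x ^ 2)|
      = (∑ x, w x * P.eval (spinSum x ^ 2) ^ 2) * (Real.pi / 2) := by
    rw [integral_finsetSum _ fun x _ => (hint x).abs.const_mul _, Finset.sum_mul]
    refine Finset.sum_congr rfl fun x _ => ?_
    rw [integral_const_mul, habs]
  have hmean : ∑ x, w x * P.eval (spinSum x ^ 2) ^ 2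
      = (∑ x : Fin n → Bool, P.eval (spinSum x ^ 2) ^ 2) / 2 ^ n := by
    have h1 : ((P ^ 2).comp (X ^ 2)).natDegree ≤ k := by
      rw [natDegree_comp, natDegree_X_pow]
      have : (P ^ 2).natDegree ≤ 2 * P.natDegree := natDegree_pow_le
      omega
    have h2 := hw.sum_eq hw1 (eval_spinSum_mem_lowDegree (n := n) h1)
    simpa only [eval_comp, eval_pow, eval_X] using h2
  rw [← hmean]
  refine le_of_mul_le_mul_right ?_ hpi
  have hmul (t : ℝ) : |t| * (Real.pi / 2) = |t * (Real.pi / 2)| := by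
    rw [abs_mul, abs_of_pos hpi]
  rw [← hR, hmul, ← hL]
  refine (abs_integral_le_integral_abs).trans (integral_mono ?_ ?_ fun y => ?_)
  · exact (integrable_finsetSum _ fun x _ => (hint x).const_mul _).abs
  · exact integrable_finsetSum _ fun x _ => (hint x).abs.const_mul _
  · exact hw.abs_sum_poisson_le hn hk hl hw0 hw1 hdeg hP y

lemma majDev_le {k : ℕ} (hn : Odd n) (hk : Even k) (hk2 : 2 ≤ k) (hkn : k < n)
    {Q : ProbabilityMeasure (Fin n → Bool)} (hQ : Q ∈ kWise n k (1 / 2)) :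
    majDev Q ≤ 2 * Real.sqrt 2 / Real.sqrt k := by
  obtain ⟨m, rfl⟩ := hk
  set l := (m + m) / 4 with hl
  obtain ⟨P, hdeg, hP, hmean⟩ := exists_christoffel (n := n) (l := l) (by omega)
  have h1 := (Balanced.of_mem_kWise hQ).abs_sum_sign_le hn (by omega) (l := l) (by omega)
    (mass_nonneg Q) (sum_mass Q) hdeg hP
  have h2 := h1.trans hmean
  rw [majDev_eq hn]
  have hml : m + m ≤ 4 * l + 2 := by omega
  have hw := wallis_pos l
  have hkpos : (0 : ℝ) < ((m + m : ℕ) : ℝ) := by exact_mod_cast (by omega : 0 < m + m)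
  -- it suffices that `√k ≤ 4 √2 (2 l + 1) C(2l, l) / 4^l`, where `k ≤ 4 l + 2`
  have h3 : Real.sqrt ((m + m : ℕ) : ℝ)
      ≤ 2 * (2 * Real.sqrt 2) * ((2 * l + 1) * wallis l) := by
    refine Real.sqrt_le_iff.2 ⟨by positivity, ?_⟩
    have hc : ((m + m : ℕ) : ℝ) ≤ 4 * l + 2 := by exact_mod_cast hml
    have hs : Real.sqrt 2 ^ 2 = 2 := Real.sq_sqrt (by norm_num)
    have e : (2 * (2 * Real.sqrt 2) * ((2 * l + 1) * wallis l)) ^ 2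
        = 32 * (2 * l + 1) * ((2 * l + 1) * wallis l ^ 2) := by
      rw [mul_pow, mul_pow, mul_pow, hs]; ring
    have h5 : (1 : ℝ) ≤ 2 * ((2 * l + 1) * wallis l ^ 2) := by
      rcases Nat.eq_zero_or_pos l with h | h
      · rw [h]; simp [wallis_zero]
      · have := one_le_wallis_sq h
        nlinarith [sq_nonneg (wallis l)]
    rw [e]
    have : (0 : ℝ) ≤ 2 * l + 1 := by positivity
    nlinarith
  have hW : 0 < (2 * (l : ℝ) + 1) * wallis l := by positivity
  calc _ ≤ (1 / ((2 * l + 1) * wallis l)) / 2 := by linarith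
    _ ≤ _ := by
      rw [div_div, div_le_div_iff₀ (by positivity) (Real.sqrt_pos.2 hkpos)]
      linarith

/-! ### Correlation of majority with a sine of the sign sum -/

lemma sum_spinSum_succ (h : ℝ → ℝ) :
    ∑ x : Fin (n + 1) → Bool, h (spinSum x)
      = ∑ x : Fin n → Bool, (h (spinSum x + 1) + h (spinSum x - 1)) := by
  rw [← (Fin.consEquiv fun _ => Bool).sum_comp, Fintype.sum_prod_type_right]
  refine Finset.sum_congr rfl fun x _ => ?_
  simp [Fin.consEquiv, spinSum, Fin.sum_univ_succ, add_comm, sub_eq_add_neg]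

lemma sum_ite_spinSum_eq (t : ℕ) :
    ∑ x : Fin n → Bool, (if spinSum x = 2 * t - n then (1 : ℝ) else 0) = n.choose t := by
  have h (x : Fin n → Bool) :
      spinSum x = 2 * t - n ↔ (Finset.univ.filter fun i => x i = true).card = t := by
    rw [spinSum_eq, sub_left_inj, mul_right_inj' two_ne_zero, Nat.cast_inj]
  simp_rw [h]
  rw [Finset.sum_boole]
  have hc : n.choose t = (powersetCard t (univ : Finset (Fin n))).card := by
    rw [card_powersetCard, card_univ, Fintype.card_fin]
  rw [hc]
  congr 1
  refine Finset.card_nbij' (fun x => Finset.univ.filter fun i => x i = true)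
    (fun s i => decide (i ∈ s)) ?_ ?_ ?_ ?_
  · intro x hx; simpa using hx
  · intro s hs; simpa using hs
  · intro x _; ext i; simp
  · intro s _; ext i; simp

/-- The correlation `E[sgn(S) sin(θ S)]` for `2j + 1` unbiased independent bits. -/
noncomputable def signSin (θ : ℝ) (j : ℕ) : ℝ :=
  (∑ x : Fin (2 * j + 1) → Bool,
    (SignType.sign (spinSum x) : ℝ) * Real.sin (θ * spinSum x)) / 2 ^ (2 * j + 1)

/-- The summand of `signSin` is an eigenfunction of the two-step walk with eigenvalue `4 cos² θ`,
apart from a positive defect where the walk can cross the origin. -/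
lemma sign_mul_sin_two_step (θ : ℝ) (m : ℤ) {s : ℝ} (hs : s = 2 * m + 1) :
    (SignType.sign (s + 2) : ℝ) * Real.sin (θ * (s + 2))
        + 2 * ((SignType.sign s : ℝ) * Real.sin (θ * s))
        + (SignType.sign (s - 2) : ℝ) * Real.sin (θ * (s - 2))
      = 4 * Real.cos θ ^ 2 * ((SignType.sign s : ℝ) * Real.sin (θ * s))
        + 2 * Real.sin θ * ((if s = 1 then 1 else 0) + if s = -1 then 1 else 0) := by
  have hadd : Real.sin (θ * (s + 2)) + Real.sin (θ * (s - 2))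
      = 2 * Real.sin (θ * s) * (2 * Real.cos θ ^ 2 - 1) := by
    rw [mul_add, mul_sub, Real.sin_add, Real.sin_sub, mul_comm θ 2, Real.cos_two_mul]; ring
  rcases lt_trichotomy m 0 with hm | rfl | hm
  · rcases (by omega : m = -1 ∨ m ≤ -2) with rfl | hm
    · have hs' : s = -1 := by rw [hs]; norm_num
      subst hs'
      norm_num at hadd ⊢
      linear_combination -hadd
    · have : (m : ℝ) ≤ -2 := by exact_mod_cast hm
      rw [sign_neg (by linarith : s + 2 < 0), sign_neg (by linarith : s < 0),
        sign_neg (by linarith : s - 2 < 0), if_neg (by intro h; linarith),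
        if_neg (by intro h; linarith)]
      simp only [SignType.coe_neg_one]
      linear_combination -hadd
  · have hs' : s = 1 := by rw [hs]; norm_num
    subst hs'
    norm_num at hadd ⊢
    linear_combination hadd
  · have : (1 : ℝ) ≤ m := by exact_mod_cast hm
    rw [sign_pos (by linarith : 0 < s + 2), sign_pos (by linarith : 0 < s),
      sign_pos (by linarith : 0 < s - 2), if_neg (by intro h; linarith),
      if_neg (by intro h; linarith)]
    simp only [SignType.coe_one]
    linear_combination hadd

lemma signSin_zero (θ : ℝ) : signSin θ 0 = Real.sin θ := by
  rw [signSin]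
  rw [sum_spinSum_succ (n := 0) fun s => (SignType.sign s : ℝ) * Real.sin (θ * s)]
  simp [spinSum]

lemma signSin_succ (θ : ℝ) (j : ℕ) :
    signSin θ (j + 1) = Real.cos θ ^ 2 * signSin θ j + Real.sin θ * wallis (j + 1) := by
  set h : ℝ → ℝ := fun s => (SignType.sign s : ℝ) * Real.sin (θ * s) with hh
  have h1 : ∑ x : Fin (2 * j + 1 + 1 + 1) → Bool, h (spinSum x)
      = ∑ x : Fin (2 * j + 1) → Bool, (h (spinSum x + 2) + 2 * h (spinSum x) + h (spinSum x - 2)) := by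
    rw [sum_spinSum_succ, sum_spinSum_succ fun s => h (s + 1) + h (s - 1)]
    refine Finset.sum_congr rfl fun x _ => ?_
    ring_nf
  have h2 : ∑ x : Fin (2 * j + 1) → Bool,
        ((if spinSum x = 1 then 1 else 0) + if spinSum x = -1 then 1 else 0)
      = ((j + 1).centralBinom : ℝ) := by
    have e1 := sum_ite_spinSum_eq (n := 2 * j + 1) (j + 1)
    have e2 := sum_ite_spinSum_eq (n := 2 * j + 1) j
    rw [show (2 * ((j + 1 : ℕ) : ℝ) - (2 * j + 1 : ℕ)) = 1 by push_cast; ring] at e1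
    rw [show (2 * (j : ℝ) - (2 * j + 1 : ℕ)) = -1 by push_cast; ring] at e2
    rw [Finset.sum_add_distrib, e1, e2, Nat.centralBinom,
      show 2 * (j + 1) = 2 * j + 1 + 1 by ring, Nat.choose_succ_succ (2 * j + 1) j]
    push_cast; rw [add_comm]
  have h3 : ∑ x : Fin (2 * j + 1 + 1 + 1) → Bool, h (spinSum x)
      = 4 * Real.cos θ ^ 2 * ∑ x : Fin (2 * j + 1) → Bool, h (spinSum x)
        + 2 * Real.sin θ * ((j + 1).centralBinom : ℝ) := by
    rw [h1, ← h2, Finset.mul_sum, Finset.mul_sum, ← Finset.sum_add_distrib]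
    refine Finset.sum_congr rfl fun x _ => ?_
    obtain ⟨m, hm⟩ := exists_spinSum_eq (n := 2 * j + 1) ⟨j, rfl⟩ x
    exact sign_mul_sin_two_step θ m hm
  have h4 : signSin θ (j + 1)
      = (∑ x : Fin (2 * j + 1 + 1 + 1) → Bool, h (spinSum x)) / 2 ^ (2 * j + 1 + 1 + 1) := rfl
  have h5 : signSin θ j = (∑ x : Fin (2 * j + 1) → Bool, h (spinSum x)) / 2 ^ (2 * j + 1) := rfl
  have h6 : (4 : ℝ) ^ (j + 1) = 2 * 2 ^ (2 * j + 1) := by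
    rw [← pow_succ', show (4 : ℝ) = 2 ^ 2 by norm_num, ← pow_mul]; congr 1
  rw [h4, h5, h3, wallis, h6]
  field_simp
  ring

lemma signSin_pi_div_two (j : ℕ) : signSin (Real.pi / 2) j = wallis j := by
  cases j with
  | zero => simp [signSin_zero, wallis_zero]
  | succ j => simp [signSin_succ]

lemma signSin_nonneg {θ : ℝ} (hθ : 0 ≤ Real.sin θ) (j : ℕ) : 0 ≤ signSin θ j := by
  induction j with
  | zero => rwa [signSin_zero]
  | succ j ih =>
    rw [signSin_succ]
    have := wallis_pos (j + 1)
    positivity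

lemma wallis_mul_le_signSin (θ : ℝ) (j : ℕ) :
    wallis j * (1 - (Real.cos θ ^ 2) ^ (j + 1)) ≤ signSin θ j * Real.sin θ := by
  have hsc := Real.sin_sq_add_cos_sq θ
  induction j with
  | zero =>
    rw [signSin_zero, wallis_zero]
    refine le_of_eq ?_
    linear_combination -hsc
  | succ j ih =>
    rw [signSin_succ]
    have hw := wallis_succ_le j
    have hc0 : 0 ≤ Real.cos θ ^ 2 := sq_nonneg _
    have hc1 : Real.cos θ ^ 2 ≤ 1 := by nlinarith [sq_nonneg (Real.sin θ)]
    have hp : 0 ≤ 1 - (Real.cos θ ^ 2) ^ (j + 1) := sub_nonneg.2 (pow_le_one₀ hc0 hc1)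
    have a1 := mul_le_mul_of_nonneg_left ih hc0
    have a2 := mul_le_mul_of_nonneg_right hw (mul_nonneg hc0 hp)
    rw [pow_succ _ (j + 1)]
    linear_combination a1 + a2 - wallis (j + 1) * hsc

/-! ### The XOR0 distribution -/

section Xor

variable {m : ℕ}

lemma walsh_univ_snoc (y : Fin m → Bool) (b : Bool) :
    walsh univ (Fin.snoc y b : Fin (m + 1) → Bool) = walsh univ y * spin b := by
  simp [walsh, Fin.prod_univ_castSucc]

lemma exists_xorLast_snoc (hm : Even m) (y : Fin m → Bool) :
    ∃ c : Bool, spin c = -walsh univ y ∧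
      ∀ b, xorLast (Fin.snoc y b : Fin (m + 1) → Bool) = Fin.snoc y c := by
  set N := (univ.filter fun i : Fin m => y i = true).card with hN
  refine ⟨decide (Odd N), ?_, fun b => ?_⟩
  · have h1 : walsh univ y = (-1) ^ N := by
      have h2 : ∀ i, spin (y i) = -1 * (if y i = true then (-1) else 1) := fun i => by
        cases y i <;> norm_num
      rw [walsh, Finset.prod_congr rfl fun i _ => h2 i, Finset.prod_mul_distrib,
        Finset.prod_const, Finset.card_univ, Fintype.card_fin, hm.neg_one_pow, one_mul,
        Finset.prod_ite, Finset.prod_const, Finset.prod_const_one, mul_one]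
    rw [h1]
    rcases Nat.even_or_odd N with h | h
    · simp [h.neg_one_pow, Nat.not_odd_iff_even.2 h]
    · simp [h.neg_one_pow, h]
  · have hcard : (univ.filter fun j : Fin (m + 1) =>
        j.val + 1 < m + 1 ∧ (Fin.snoc y b : Fin (m + 1) → Bool) j = true).card = N := by
      rw [hN, ← Finset.card_map (s := univ.filter fun i : Fin m => y i = true) Fin.castSuccEmb]
      refine congrArg Finset.card (Finset.ext fun j => ?_)
      refine Fin.lastCases ?_ (fun i => ?_) j
      · simp [Fin.ext_iff, Fin.val_last, (Fin.is_lt _).ne]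
      · simp
    ext j
    refine Fin.lastCases ?_ (fun i => ?_) j
    · simp only [xorLast, Fin.val_last, lt_irrefl, if_false, Fin.snoc_last]
      rw [hcard]
    · simp [xorLast]

lemma sum_xorLast (hm : Even m) (h : (Fin (m + 1) → Bool) → ℝ) :
    ∑ x, h (xorLast x) = ∑ x, h x * (1 - walsh univ x) := by
  rw [← (Fin.snocEquiv fun _ => Bool).sum_comp, ← (Fin.snocEquiv fun _ => Bool).sum_comp,
    Fintype.sum_prod_type_right, Fintype.sum_prod_type_right]
  refine Finset.sum_congr rfl fun y _ => ?_
  obtain ⟨c, hc, hx⟩ := exists_xorLast_snoc hm y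
  have e (b : Bool) : (Fin.snocEquiv fun _ => Bool) (b, y) = (Fin.snoc y b : Fin (m + 1) → Bool) :=
    rfl
  simp only [e, hx, walsh_univ_snoc, Fintype.sum_bool, spin_true, spin_false]
  rw [← neg_neg (walsh univ y), ← hc]
  cases c <;> simp <;> ring

end Xor

lemma sum_mass_xor0 (hn : Odd n) (h : (Fin n → Bool) → ℝ) :
    ∑ x, mass (xor0 n) x * h x = (∑ x, h x * (1 - walsh univ x)) / 2 ^ n := by
  obtain ⟨m, rfl⟩ := hn
  rw [← integral_eq_sum_mass, ← sum_xorLast (even_two_mul m)]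
  simp only [xor0, ProbabilityMeasure.coe_mk]
  rw [← PMF.toMeasure_map _ _ (measurable_of_finite _),
    integral_map (measurable_of_finite _).aemeasurable
      (measurable_of_finite _).aestronglyMeasurable, PMF.integral_eq_sum]
  simp [PMF.uniformOfFintype_apply, div_eq_inv_mul, Finset.mul_sum]

lemma balanced_xor0 (hn : Odd n) : Balanced (n - 1) (mass (xor0 n)) := by
  intro T hT hcard
  rw [sum_mass_xor0 hn]
  simp_rw [mul_sub, mul_one]
  rw [Finset.sum_sub_distrib, sum_walsh hT, sum_walsh_mul_walsh, if_neg, sub_zero, zero_div]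
  rintro rfl
  rw [card_univ, Fintype.card_fin] at hcard
  have := hn.pos
  omega

lemma prod_exp_spin (θ : ℝ) (x : Fin n → Bool) :
    ∏ i, Complex.exp ((θ * spin (x i) : ℝ) * Complex.I)
      = Complex.exp ((θ * spinSum x : ℝ) * Complex.I) := by
  rw [← Complex.exp_sum, spinSum, Finset.mul_sum, ← Finset.sum_mul]
  push_cast; rfl

/-- The parity character is, up to a global sign, the sine of `π/2` times the sign sum. -/
lemma sin_pi_div_two_mul_spinSum {j : ℕ} (x : Fin (2 * j + 1) → Bool) :
    Real.sin (Real.pi / 2 * spinSum x) = (-1) ^ j * walsh univ x := by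
  have h (b : Bool) : Complex.exp ((Real.pi / 2 * spin b : ℝ) * Complex.I)
      = (spin b : ℝ) * Complex.I := by
    cases b
    · simp [Complex.exp_neg, Complex.exp_pi_div_two_mul_I]
    · simp [Complex.exp_pi_div_two_mul_I]
  have h1 := prod_exp_spin (Real.pi / 2) x
  simp_rw [h] at h1
  rw [Finset.prod_mul_distrib, ← Complex.ofReal_prod, Finset.prod_const, card_univ,
    Fintype.card_fin, pow_succ, pow_mul, Complex.I_sq] at h1
  have h2 := congrArg Complex.im h1
  rw [Complex.exp_ofReal_mul_I_im] at h2
  rw [← h2, walsh, show ((-1 : ℂ) ^ j) = (((-1 : ℝ) ^ j : ℝ) : ℂ) by push_cast; rfl,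
    ← mul_assoc, ← Complex.ofReal_mul, Complex.im_ofReal_mul, Complex.I_im]
  ring

lemma majDev_xor0 (j : ℕ) : majDev (xor0 (2 * j + 1)) = wallis j / 2 := by
  have hn : Odd (2 * j + 1) := ⟨j, rfl⟩
  rw [majDev_eq hn, sum_mass_xor0 hn]
  congr 1
  have h0 : ∑ x : Fin (2 * j + 1) → Bool, (SignType.sign (spinSum x) : ℝ) = 0 :=
    sum_odd_eq_zero (f := fun s => (SignType.sign s : ℝ)) fun s => by
      rw [Left.sign_neg]; simp
  have hu : ((-1 : ℝ) ^ j) * (-1) ^ j = 1 := by rw [← mul_pow]; simp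
  have h1 : ∑ x : Fin (2 * j + 1) → Bool,
      (SignType.sign (spinSum x) : ℝ) * (1 - walsh univ x)
      = -(-1) ^ j * ∑ x : Fin (2 * j + 1) → Bool,
        (SignType.sign (spinSum x) : ℝ) * Real.sin (Real.pi / 2 * spinSum x) := by
    simp_rw [mul_sub, mul_one, sin_pi_div_two_mul_spinSum]
    rw [Finset.sum_sub_distrib, h0, zero_sub, Finset.mul_sum, ← Finset.sum_neg_distrib]
    refine Finset.sum_congr rfl fun x _ => ?_
    linear_combination (SignType.sign (spinSum x) : ℝ) * walsh univ x * hu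
  rw [h1, mul_div_assoc, ← signSin, signSin_pi_div_two, abs_mul, abs_neg, abs_pow, abs_neg, abs_one,
    one_pow, one_mul, abs_of_pos (wallis_pos j)]

lemma le_majDev_xor0 (hn : Odd n) (hn3 : 3 ≤ n) :
    1 / (3 * Real.sqrt n) ≤ majDev (xor0 n) := by
  obtain ⟨j, rfl⟩ := hn
  rw [majDev_xor0]
  have hj : 1 ≤ j := by omega
  have hj' : (1 : ℝ) ≤ j := by exact_mod_cast hj
  have h := one_le_wallis_sq hj
  have hw := wallis_pos j
  have hs : 0 < Real.sqrt ((2 * j + 1 : ℕ) : ℝ) := Real.sqrt_pos.2 (by positivity)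
  have hsq : Real.sqrt ((2 * j + 1 : ℕ) : ℝ) ^ 2 = 2 * j + 1 := by
    rw [Real.sq_sqrt (by positivity)]; push_cast; rfl
  rw [div_le_div_iff₀ (by positivity) two_pos, one_mul]
  refine abs_le_of_sq_le_sq' (a := 2) ?_ (by positivity) |>.2
  rw [mul_pow, mul_pow, hsq]
  nlinarith [sq_nonneg (wallis j)]

/-! ### A bounded function orthogonal to low degrees -/

/-- The imaginary part of `∏ (1 + i τ σ_j)`, an unnormalized sine of the sign sum. -/
noncomputable def imProd (τ : ℝ) (x : Fin n → Bool) : ℝ :=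
  (∏ i, (1 + (τ * spin (x i) : ℝ) * Complex.I)).im

lemma imProd_eq (τ : ℝ) (x : Fin n → Bool) :
    imProd τ x = Real.sqrt (1 + τ ^ 2) ^ n * Real.sin (Real.arctan τ * spinSum x) := by
  have hs : Real.sqrt (1 + τ ^ 2) ≠ 0 := (Real.sqrt_pos.2 (by positivity)).ne'
  have h1 : Real.sqrt (1 + τ ^ 2) * Real.cos (Real.arctan τ) = 1 := by
    rw [Real.cos_arctan]; field_simp
  have h2 : Real.sqrt (1 + τ ^ 2) * Real.sin (Real.arctan τ) = τ := by
    rw [Real.sin_arctan]; field_simp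
  have h (b : Bool) : (1 + (τ * spin b : ℝ) * Complex.I)
      = (Real.sqrt (1 + τ ^ 2) : ℂ) *
        Complex.exp ((Real.arctan τ * spin b : ℝ) * Complex.I) := by
    apply Complex.ext
    · rw [Complex.re_ofReal_mul, Complex.exp_ofReal_mul_I_re]
      cases b <;> simp [h1]
    · rw [Complex.im_ofReal_mul, Complex.exp_ofReal_mul_I_im]
      cases b <;> simp [h2]
  rw [imProd, Finset.prod_congr rfl fun i _ => h (x i), Finset.prod_mul_distrib, prod_exp_spin,
    Finset.prod_const, card_univ, Fintype.card_fin, ← Complex.ofReal_pow, Complex.im_ofReal_mul,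
    Complex.exp_ofReal_mul_I_im]

lemma abs_imProd_le (τ : ℝ) (x : Fin n → Bool) : |imProd τ x| ≤ Real.sqrt (1 + τ ^ 2) ^ n := by
  rw [imProd_eq, abs_mul, abs_of_nonneg (by positivity)]
  exact mul_le_of_le_one_right (by positivity) (Real.abs_sin_le_one _)

lemma sum_walsh_mul_imProd (τ : ℝ) (T : Finset (Fin n)) :
    ∑ x, walsh T x * imProd τ x = 2 ^ n * (Complex.I ^ T.card).im * τ ^ T.card := by
  have h1 (x : Fin n → Bool) : ((walsh T x : ℝ) : ℂ) * ∏ i, (1 + (τ * spin (x i) : ℝ) * Complex.I)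
      = ∏ i, ((if i ∈ T then (spin (x i) : ℂ) else 1) *
          (1 + (τ * spin (x i) : ℝ) * Complex.I)) := by
    rw [Finset.prod_mul_distrib, walsh]
    simp [Finset.prod_ite_mem]
  have h2 : ∑ x : Fin n → Bool,
      ((walsh T x : ℝ) : ℂ) * ∏ i, (1 + (τ * spin (x i) : ℝ) * Complex.I)
      = ((2 ^ n * τ ^ T.card : ℝ) : ℂ) * Complex.I ^ T.card := by
    simp_rw [h1]
    rw [sum_cube_prod fun i b => (if i ∈ T then (spin b : ℂ) else 1) *
      (1 + (τ * spin b : ℝ) * Complex.I)]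
    have h3 (i : Fin n) : (if i ∈ T then (spin true : ℂ) else 1) *
          (1 + (τ * spin true : ℝ) * Complex.I) + (if i ∈ T then (spin false : ℂ) else 1) *
          (1 + (τ * spin false : ℝ) * Complex.I)
        = 2 * if i ∈ T then (τ : ℂ) * Complex.I else 1 := by
      split_ifs <;> simp <;> ring
    rw [Finset.prod_congr rfl fun i _ => h3 i, Finset.prod_mul_distrib, Finset.prod_ite_mem]
    simp [mul_pow, mul_assoc]
  have h3 := congrArg Complex.im h2
  rw [Complex.im_sum, Complex.im_ofReal_mul] at h3
  simp_rw [Complex.im_ofReal_mul] at h3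
  calc _ = _ := h3
    _ = _ := by ring

/-- Newton's forward difference formula for a monomial of degree at most `k`. -/
lemma pow_eq_sum_choose {d k N : ℕ} (hd : d ≤ k) (hkN : k ≤ N) :
    (N : ℝ) ^ d = ∑ i ∈ range (k + 1), ∑ a ∈ range (i + 1),
      (N.choose i : ℝ) * ((-1) ^ (i - a) * i.choose a) * (a : ℝ) ^ d := by
  have h := shift_eq_sum_fwdDiff_iter (1 : ℝ) (fun r : ℝ => r ^ d) N 0
  simp only [zero_add, nsmul_eq_mul, mul_one] at h
  rw [h]
  symm
  refine Eq.trans (Finset.sum_congr rfl fun i _ => ?_)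
    (Finset.sum_subset (range_subset_range.2 (by omega)) fun i _ hi => ?_)
  · rw [fwdDiff_iter_eq_sum_shift, Finset.mul_sum]
    refine Finset.sum_congr rfl fun a _ => ?_
    simp [zsmul_eq_mul, mul_assoc]
  · have hi' : d < i := by have := mt mem_range.2 hi; omega
    rw [fwdDiff_iter_pow_eq_zero_of_lt hi', Pi.zero_apply, mul_zero]

/-- The combination of `imProd` at the nodes `0, h, …, k h` that extrapolates it to `N h`: by the
forward difference formula it has the same Walsh coefficients as `imProd (N h)` in degrees at most
`k`. -/
noncomputable def extrapolant (k N : ℕ) (h : ℝ) (x : Fin n → Bool) : ℝ :=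
  ∑ i ∈ range (k + 1), ∑ a ∈ range (i + 1),
    (N.choose i : ℝ) * ((-1) ^ (i - a) * i.choose a) * imProd (a * h) x

lemma sum_walsh_mul_sub_extrapolant {k N : ℕ} (hkN : k ≤ N) (h : ℝ) {T : Finset (Fin n)}
    (hT : T.card ≤ k) : ∑ x, walsh T x * (imProd (N * h) x - extrapolant k N h x) = 0 := by
  have h1 : ∑ x, walsh T x * extrapolant k N h x
      = ∑ i ∈ range (k + 1), ∑ a ∈ range (i + 1),
        (N.choose i : ℝ) * ((-1) ^ (i - a) * i.choose a) * ∑ x, walsh T x * imProd (a * h) x := by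
    simp_rw [extrapolant, Finset.mul_sum]
    rw [Finset.sum_comm]
    refine Finset.sum_congr rfl fun i _ => ?_
    rw [Finset.sum_comm]
    refine Finset.sum_congr rfl fun a _ => Finset.sum_congr rfl fun x _ => ?_
    ring
  simp_rw [mul_sub]
  rw [Finset.sum_sub_distrib, h1, sub_eq_zero]
  simp_rw [sum_walsh_mul_imProd, mul_pow]
  rw [pow_eq_sum_choose hT hkN, Finset.sum_mul, Finset.mul_sum]
  refine Finset.sum_congr rfl fun i _ => ?_
  rw [Finset.sum_mul, Finset.mul_sum]
  refine Finset.sum_congr rfl fun a _ => ?_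
  ring

/-- The weights of the extrapolation from `k + 1` nodes to `N = 8k` have total mass at most
`(16 e)^k`. -/
lemma abs_extrapolant_le {k : ℕ} {h : ℝ} (hh : 0 ≤ h) (x : Fin n → Bool) :
    |extrapolant k (8 * k) h x|
      ≤ 16 ^ k * Real.exp k * Real.sqrt (1 + (k * h) ^ 2) ^ n := by
  set R := Real.sqrt (1 + (k * h) ^ 2) ^ n with hR
  have hR0 : 0 ≤ R := by positivity
  have hnode {i a : ℕ} (hi : i ∈ range (k + 1)) (ha : a ∈ range (i + 1)) :
      |imProd (a * h) x| ≤ R := by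
    refine (abs_imProd_le _ x).trans ?_
    have : (a : ℝ) ≤ k := by
      have := mem_range.1 hi; have := mem_range.1 ha
      exact_mod_cast (by omega : a ≤ k)
    rw [hR]
    gcongr
  have hrow {i : ℕ} (hi : i ∈ range (k + 1)) :
      |∑ a ∈ range (i + 1), ((8 * k).choose i : ℝ) * ((-1) ^ (i - a) * i.choose a)
        * imProd (a * h) x| ≤ 16 ^ k * ((k : ℝ) ^ i / i.factorial) * R := by
    calc _ ≤ ∑ a ∈ range (i + 1), |((8 * k).choose i : ℝ) * ((-1) ^ (i - a) * i.choose a)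
            * imProd (a * h) x| := Finset.abs_sum_le_sum_abs _ _
      _ ≤ ∑ a ∈ range (i + 1), ((8 * k).choose i : ℝ) * i.choose a * R := by
          refine Finset.sum_le_sum fun a ha => ?_
          rw [abs_mul, abs_mul, abs_mul, abs_pow, abs_neg, abs_one, one_pow, one_mul,
            Nat.abs_cast, Nat.abs_cast]
          exact mul_le_mul_of_nonneg_left (hnode hi ha) (by positivity)
      _ = ((8 * k).choose i : ℝ) * 2 ^ i * R := by
          rw [← Finset.sum_mul, ← Finset.mul_sum]
          congr 2
          exact_mod_cast Nat.sum_range_choose i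
      _ ≤ _ := by
          refine mul_le_mul_of_nonneg_right ?_ hR0
          have h1 : ((8 * k).choose i : ℝ) ≤ ((8 * k : ℕ) : ℝ) ^ i / i.factorial :=
            Nat.choose_le_pow_div i (8 * k)
          have h2 : (16 : ℝ) ^ i ≤ 16 ^ k :=
            pow_le_pow_right₀ (by norm_num) (by have := mem_range.1 hi; omega)
          calc ((8 * k).choose i : ℝ) * 2 ^ i
              ≤ ((8 * k : ℕ) : ℝ) ^ i / i.factorial * 2 ^ i := by gcongr
            _ = 16 ^ i * ((k : ℝ) ^ i / i.factorial) := by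
                rw [show (16 : ℝ) = 8 * 2 by norm_num, mul_pow]
                push_cast
                rw [mul_pow]; ring
            _ ≤ _ := by gcongr
  calc |extrapolant k (8 * k) h x|
      ≤ ∑ i ∈ range (k + 1), 16 ^ k * ((k : ℝ) ^ i / i.factorial) * R :=
        (Finset.abs_sum_le_sum_abs _ _).trans (Finset.sum_le_sum fun i hi => hrow hi)
    _ = 16 ^ k * (∑ i ∈ range (k + 1), (k : ℝ) ^ i / i.factorial) * R := by
        rw [← Finset.sum_mul, ← Finset.mul_sum]
    _ ≤ _ := by
        have := Real.sum_le_exp_of_nonneg (x := (k : ℝ)) (by positivity) (k + 1)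
        gcongr

/-- A density `(1 + g / 2) / 2^n` with `|g| ≤ 2` and `g` orthogonal to all Walsh characters of degree
at most `k` is an admissible distribution. -/
lemma exists_kWise_of_orthogonal {k : ℕ} (hn : Odd n) (hk : 1 ≤ k) {g : (Fin n → Bool) → ℝ}
    (hg : ∀ x, |g x| ≤ 2) (horth : ∀ T : Finset (Fin n), T.card ≤ k → ∑ x, walsh T x * g x = 0) :
    ∃ Q ∈ kWise n k (1 / 2),
      majDev Q = |(∑ x, (SignType.sign (spinSum x) : ℝ) * g x) / 2 ^ n| / 4 := by
  have hp : (0 : ℝ) < 2 ^ n := by positivity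
  have h0 : ∑ x, g x = 0 := by simpa using horth ∅ (by simp)
  obtain ⟨Q, hQ⟩ := exists_mass_eq (w := fun x => (1 + g x / 2) / 2 ^ n)
    (fun x => by
      have := (abs_le.1 (hg x)).1
      refine div_nonneg ?_ hp.le
      linarith)
    (by
      rw [← Finset.sum_div, Finset.sum_add_distrib, ← Finset.sum_div, h0, card_cube]
      field_simp
      simp)
  refine ⟨Q, (mem_kWise_iff hk).2 ?_, ?_⟩
  · intro T hT hTk
    rw [hQ]
    calc ∑ x, (1 + g x / 2) / 2 ^ n * walsh T x
        = (∑ x, walsh T x + (∑ x, walsh T x * g x) / 2) / 2 ^ n := by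
          rw [Finset.sum_div, ← Finset.sum_add_distrib, Finset.sum_div]
          exact Finset.sum_congr rfl fun x _ => by ring
      _ = 0 := by rw [sum_walsh hT, horth T hTk]; simp
  · have hs : ∑ x : Fin n → Bool, (SignType.sign (spinSum x) : ℝ) = 0 :=
      sum_odd_eq_zero (f := fun s => (SignType.sign s : ℝ)) fun s => by
        rw [Left.sign_neg]; simp
    rw [majDev_eq hn, hQ]
    have : ∑ x, (1 + g x / 2) / 2 ^ n * (SignType.sign (spinSum x) : ℝ)
        = (∑ x, (SignType.sign (spinSum x) : ℝ) * g x) / 2 ^ n / 2 := by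
      calc _ = (∑ x : Fin n → Bool, (SignType.sign (spinSum x) : ℝ)
            + (∑ x, (SignType.sign (spinSum x) : ℝ) * g x) / 2) / 2 ^ n := by
            rw [Finset.sum_div, ← Finset.sum_add_distrib, Finset.sum_div]
            exact Finset.sum_congr rfl fun x _ => by ring
        _ = _ := by rw [hs]; ring
    rw [this, abs_div, abs_two, div_div]
    norm_num

/-! ### The lower bound -/

lemma exp_half_le_one_add {t : ℝ} (h0 : 0 ≤ t) (h1 : t ≤ 1) : Real.exp (t / 2) ≤ 1 + t := by
  have h := Real.one_sub_le_exp_neg (t / 2)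
  rw [Real.exp_neg] at h
  have hpos := Real.exp_pos (t / 2)
  have h2 : (1 - t / 2) * Real.exp (t / 2) ≤ 1 := by
    calc _ ≤ (Real.exp (t / 2))⁻¹ * Real.exp (t / 2) := by gcongr
      _ = 1 := inv_mul_cancel₀ hpos.ne'
  nlinarith

/-- The extrapolation error: the growth `(16 e)^k e^{k/2}` of the extrapolant loses against the
growth `e^{16 k}` of the extrapolated function. -/
lemma extrapolation_error_le {k : ℕ} (hk : 2 ≤ k) (hkn : 64 * k < n) {h : ℝ}
    (hh : h ^ 2 * (k * n) = 1) :
    16 ^ k * Real.exp k * Real.sqrt (1 + (k * h) ^ 2) ^ n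
      ≤ Real.sqrt (1 + (8 * (k * h)) ^ 2) ^ n * (1 / (64 * Real.sqrt k)) := by
  have hk' : (2 : ℝ) ≤ k := by exact_mod_cast hk
  have hn' : 64 * (k : ℝ) < n := by exact_mod_cast hkn
  have hn0 : (0 : ℝ) < n := by linarith
  have hsq : (k * h) ^ 2 = k / n := by
    rw [eq_div_iff hn0.ne']
    linear_combination (k : ℝ) * hh
  have hA : Real.sqrt (1 + (k * h) ^ 2) ^ n ≤ Real.exp (k / 2) := by
    have h1 : Real.sqrt (1 + (k * h) ^ 2) ≤ Real.exp (k / n / 2) := by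
      refine Real.sqrt_le_iff.2 ⟨(Real.exp_pos _).le, ?_⟩
      rw [← Real.exp_nat_mul, hsq]
      have := Real.add_one_le_exp ((k : ℝ) / n)
      calc 1 + (k : ℝ) / n ≤ Real.exp (k / n) := by linarith
        _ = _ := by congr 1; push_cast; ring
    calc _ ≤ Real.exp (k / n / 2) ^ n := by gcongr
      _ = _ := by rw [← Real.exp_nat_mul]; congr 1; field_simp
  have hB : Real.exp (16 * k) ≤ Real.sqrt (1 + (8 * (k * h)) ^ 2) ^ n := by
    have e : (8 * (k * h)) ^ 2 = 64 * k / n := by rw [mul_pow, hsq]; ring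
    have h1 : Real.exp (64 * k / n / 4) ≤ Real.sqrt (1 + (8 * (k * h)) ^ 2) := by
      refine Real.le_sqrt_of_sq_le ?_
      rw [← Real.exp_nat_mul, e]
      calc _ = Real.exp (64 * k / n / 2) := by congr 1; push_cast; ring
        _ ≤ _ := exp_half_le_one_add (by positivity) (by rw [div_le_one hn0]; exact hn'.le)
    calc Real.exp (16 * k) = Real.exp (64 * k / n / 4) ^ n := by
          rw [← Real.exp_nat_mul]; congr 1; field_simp; ring
      _ ≤ _ := by gcongr
  have h16 : (16 : ℝ) ^ k ≤ Real.exp (3 * k) := by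
    have h3 : (16 : ℝ) ≤ Real.exp 3 := by
      have := Real.exp_one_gt_d9
      calc (16 : ℝ) ≤ 2.7 ^ 3 := by norm_num
        _ ≤ Real.exp 1 ^ 3 := by gcongr; linarith
        _ = Real.exp 3 := by rw [← Real.exp_nat_mul]; norm_num
    calc (16 : ℝ) ^ k ≤ Real.exp 3 ^ k := by gcongr
      _ = _ := by rw [← Real.exp_nat_mul, mul_comm]
  have hsmall : 64 * Real.sqrt k ≤ Real.exp (23 / 2 * k) := by
    have h1 := Real.pow_div_factorial_le_exp (23 / 2 * k : ℝ) (by positivity) 2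
    have h2 : Real.sqrt k ≤ k :=
      Real.sqrt_le_iff.2 ⟨by positivity, by nlinarith⟩
    norm_num [Nat.factorial] at h1
    nlinarith
  have hs : 0 < Real.sqrt k := Real.sqrt_pos.2 (by linarith)
  calc 16 ^ k * Real.exp k * Real.sqrt (1 + (k * h) ^ 2) ^ n
      ≤ Real.exp (3 * k) * Real.exp k * Real.exp (k / 2) := by gcongr
    _ = Real.exp (16 * k) * (1 / Real.exp (23 / 2 * k)) := by
      rw [← Real.exp_add, ← Real.exp_add, one_div, ← Real.exp_neg, ← Real.exp_add]
      congr 1; ring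
    _ ≤ _ := by gcongr

/-- The main term: at the frequency `arctan Λ` with `Λ² = 64 k / n` the correlation of majority with
the sine is of order `1 / √k`. -/
lemma le_signSin_arctan {j k : ℕ} (hk : 1 ≤ k) (hkn : 64 * k < 2 * j + 1) {Λ : ℝ} (hΛ : 0 < Λ)
    (hΛ2 : Λ ^ 2 * (2 * j + 1) = 64 * k) :
    1 / (32 * Real.sqrt k) ≤ signSin (Real.arctan Λ) j := by
  have hk' : (1 : ℝ) ≤ k := by exact_mod_cast hk
  have hj : 1 ≤ j := by omega
  have hj' : (1 : ℝ) ≤ j := by exact_mod_cast hj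
  have hw := wallis_pos j
  have hs1 : 1 ≤ Real.sqrt (1 + Λ ^ 2) := Real.one_le_sqrt.2 (by nlinarith [sq_nonneg Λ])
  have hsin0 : 0 ≤ Real.sin (Real.arctan Λ) := by rw [Real.sin_arctan]; positivity
  have hsin : Real.sin (Real.arctan Λ) ≤ Λ := by
    rw [Real.sin_arctan]; exact div_le_self hΛ.le hs1
  have hF := signSin_nonneg hsin0 j
  have hcos : (Real.cos (Real.arctan Λ) ^ 2) ^ (j + 1) ≤ 1 / 2 := by
    rw [Real.cos_sq_arctan, div_pow, one_pow]
    refine one_div_le_one_div_of_le two_pos ?_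
    have hb := one_add_mul_le_pow (a := Λ ^ 2) (by nlinarith [sq_nonneg Λ]) (j + 1)
    push_cast at hb
    nlinarith [sq_nonneg Λ]
  have h1 := wallis_mul_le_signSin (Real.arctan Λ) j
  have h2 : wallis j / 2 ≤ signSin (Real.arctan Λ) j * Λ := by
    calc wallis j / 2 ≤ wallis j * (1 - (Real.cos (Real.arctan Λ) ^ 2) ^ (j + 1)) := by nlinarith
      _ ≤ _ := h1
      _ ≤ _ := mul_le_mul_of_nonneg_left hsin hF
  set F := signSin (Real.arctan Λ) j
  have h3 : wallis j ^ 2 / 4 ≤ F ^ 2 * Λ ^ 2 := by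
    have := pow_le_pow_left₀ (by positivity) h2 2
    rw [mul_pow] at this
    linarith
  have h4 := one_le_wallis_sq hj
  have h5 : 1 ≤ 512 * (F ^ 2 * k) := by
    have e : F ^ 2 * k * 64 = F ^ 2 * Λ ^ 2 * (2 * j + 1) := by rw [mul_assoc, mul_assoc, hΛ2]; ring
    have h6 := mul_le_mul_of_nonneg_right h3 (by positivity : (0 : ℝ) ≤ 2 * j + 1)
    nlinarith [sq_nonneg (wallis j)]
  have hs : 0 < Real.sqrt k := Real.sqrt_pos.2 (by linarith)
  have hsq : Real.sqrt k ^ 2 = k := Real.sq_sqrt (by linarith)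
  rw [div_le_iff₀ (by positivity)]
  refine abs_le_of_sq_le_sq' (a := 1) ?_ (by positivity) |>.2
  rw [mul_pow, mul_pow, hsq]
  linarith

lemma exists_le_majDev_of_lt {k : ℕ} (hn : Odd n) (hk : 2 ≤ k) (hkn : 64 * k < n) :
    ∃ Q ∈ kWise n k (1 / 2), 1 / (256 * Real.sqrt k) ≤ majDev Q := by
  have hk0 : (0 : ℝ) < k := by exact_mod_cast (by omega : 0 < k)
  have hn0 : (0 : ℝ) < n := by exact_mod_cast (by omega : 0 < n)
  -- the nodes end at `k h = √(k / n)`, and the extrapolation goes to `8 k h = 8 √(k / n) < 1`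
  set h : ℝ := (Real.sqrt (k * n))⁻¹ with hh
  have hhpos : 0 < h := inv_pos.2 (Real.sqrt_pos.2 (by positivity))
  have hh2 : h ^ 2 * (k * n) = 1 := by
    rw [hh, inv_pow, Real.sq_sqrt (by positivity)]
    exact inv_mul_cancel₀ (by positivity)
  set B : ℝ := Real.sqrt (1 + (8 * (k * h)) ^ 2) ^ n with hB
  have hBpos : 0 < B := by positivity
  -- `δ` bounds the subtracted part and is half of the bound `1 / (32 √k)` for the main term
  set δ : ℝ := 1 / (64 * Real.sqrt k) with hδ
  have hsk : 1 ≤ Real.sqrt k := Real.one_le_sqrt.2 (by exact_mod_cast (by omega : 1 ≤ k))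
  have hδ1 : δ ≤ 1 := by
    rw [hδ, div_le_one (by positivity)]; linarith
  have harg : ((8 * k : ℕ) : ℝ) * h = 8 * (k * h) := by push_cast; ring
  have herr (x : Fin n → Bool) : |extrapolant k (8 * k) h x / B| ≤ δ := by
    rw [abs_div, abs_of_pos hBpos, div_le_iff₀ hBpos, mul_comm δ]
    exact (abs_extrapolant_le hhpos.le x).trans (extrapolation_error_le hk hkn hh2)
  have hmain (x : Fin n → Bool) : imProd ((8 * k : ℕ) * h) x / B
      = Real.sin (Real.arctan (8 * (k * h)) * spinSum x) := by
    rw [imProd_eq, harg, ← hB, mul_div_cancel_left₀ _ hBpos.ne']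
  obtain ⟨Q, hQ, hdev⟩ := exists_kWise_of_orthogonal (k := k) hn (by omega)
    (g := fun x => (imProd ((8 * k : ℕ) * h) x - extrapolant k (8 * k) h x) / B)
    (fun x => by
      rw [sub_div, hmain]
      refine (abs_sub _ _).trans ?_
      have := Real.abs_sin_le_one (Real.arctan (8 * (k * h)) * spinSum x)
      linarith [herr x])
    (fun T hT => by
      simp_rw [← mul_div_assoc]
      rw [← Finset.sum_div, sum_walsh_mul_sub_extrapolant (by omega) h hT, zero_div])
  refine ⟨Q, hQ, ?_⟩
  rw [hdev]
  obtain ⟨j, rfl⟩ := hn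
  have hF := le_signSin_arctan (j := j) (k := k) (Λ := 8 * (k * h)) (by omega) hkn (by positivity)
    (by
      push_cast at hh2
      linear_combination (64 * k : ℝ) * hh2)
  have hsum : (∑ x : Fin (2 * j + 1) → Bool, (SignType.sign (spinSum x) : ℝ) *
        ((imProd ((8 * k : ℕ) * h) x - extrapolant k (8 * k) h x) / B)) / 2 ^ (2 * j + 1)
      = signSin (Real.arctan (8 * (k * h))) j - (∑ x : Fin (2 * j + 1) → Bool,
        (SignType.sign (spinSum x) : ℝ) * (extrapolant k (8 * k) h x / B)) / 2 ^ (2 * j + 1) := by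
    simp_rw [sub_div, hmain, mul_sub]
    rw [Finset.sum_sub_distrib, sub_div, signSin]
  have hrest : (∑ x : Fin (2 * j + 1) → Bool,
      (SignType.sign (spinSum x) : ℝ) * (extrapolant k (8 * k) h x / B)) / 2 ^ (2 * j + 1) ≤ δ := by
    rw [div_le_iff₀ (by positivity)]
    calc _ ≤ ∑ _x : Fin (2 * j + 1) → Bool, δ := by
          refine Finset.sum_le_sum fun x _ => ?_
          refine (le_abs_self _).trans ?_
          rw [abs_mul]
          refine (mul_le_of_le_one_left (abs_nonneg _) ?_).trans (herr x)
          rcases SignType.sign (spinSum x) with _ | _ | _ <;> simp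
      _ = _ := by simp [mul_comm]
  rw [hsum]
  have h32 : 1 / (32 * Real.sqrt k) = 2 * δ := by rw [hδ]; field_simp; norm_num
  have h256 : 1 / (256 * Real.sqrt k) = δ / 4 := by rw [hδ]; field_simp; norm_num
  rw [h256]
  have := le_abs_self (signSin (Real.arctan (8 * (k * h))) j - (∑ x : Fin (2 * j + 1) → Bool,
        (SignType.sign (spinSum x) : ℝ) * (extrapolant k (8 * k) h x / B)) / 2 ^ (2 * j + 1))
  linarith

lemma exists_le_majDev {k : ℕ} (hn : Odd n) (hk : 2 ≤ k) (hkn : k < n) :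
    ∃ Q ∈ kWise n k (1 / 2), 1 / (256 * Real.sqrt k) ≤ majDev Q := by
  rcases lt_or_ge (64 * k) n with h | h
  · exact exists_le_majDev_of_lt hn hk h
  · refine ⟨xor0 n, (mem_kWise_iff (by omega)).2 fun T hT hTk =>
      balanced_xor0 hn T hT (by omega), le_trans ?_ (le_majDev_xor0 hn (by omega))⟩
    have hn0 : (0 : ℝ) < n := by exact_mod_cast (by omega : 0 < n)
    have h1 : Real.sqrt n ≤ 8 * Real.sqrt k := by
      refine Real.sqrt_le_iff.2 ⟨by positivity, ?_⟩
      rw [mul_pow, Real.sq_sqrt (by positivity)]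
      norm_num
      exact_mod_cast h
    have := Real.sqrt_pos.2 hn0
    refine one_div_le_one_div_of_le (by positivity) ?_
    linarith

end KWiseBits

theorem mainTheorem2 :
    (∃ C : ℝ, 0 < C ∧ ∀ n k : ℕ, Odd n → Even k → 2 ≤ k → k < n →
      ∃ M : ℝ, IsGreatest (KWiseBits.majDev '' KWiseBits.kWise n k (1 / 2)) M ∧
        C / Real.sqrt (k * Real.log k) ≤ M ∧ M ≤ 2 * Real.sqrt 2 / Real.sqrt k) ∧
    (∀ n : ℕ, Odd n → 3 ≤ n →
      KWiseBits.xor0 n ∈ KWiseBits.kWise n (n - 1) (1 / 2) ∧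
        1 / (3 * Real.sqrt n) ≤ KWiseBits.majDev (KWiseBits.xor0 n)) := by
  have hlog2 : 0 < Real.log 2 := Real.log_pos one_lt_two
  refine ⟨⟨Real.sqrt (Real.log 2) / 256, by positivity, fun n k hn hk hk2 hkn => ?_⟩,
    fun n hn hn3 => ⟨(KWiseBits.mem_kWise_iff (by omega)).2 (KWiseBits.balanced_xor0 hn),
      KWiseBits.le_majDev_xor0 hn hn3⟩⟩
  obtain ⟨M, hM⟩ := KWiseBits.exists_isGreatest hn (k := k) (by omega)
  refine ⟨M, hM, ?_, ?_⟩
  · obtain ⟨Q, hQ, hdev⟩ := KWiseBits.exists_le_majDev hn hk2 hkn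
    refine le_trans ?_ (hdev.trans (hM.2 ⟨Q, hQ, rfl⟩))
    have hk2' : (2 : ℝ) ≤ k := by exact_mod_cast hk2
    have hlog : Real.sqrt (Real.log 2) ≤ Real.sqrt (Real.log k) :=
      Real.sqrt_le_sqrt (Real.log_le_log two_pos hk2')
    have hl0 : 0 < Real.sqrt (Real.log 2) := Real.sqrt_pos.2 hlog2
    have hk0 : 0 < Real.sqrt k := Real.sqrt_pos.2 (by linarith)
    -- `log k` is bounded below, so that a bound of order `1 / √k` is enough
    have hlk : 0 < Real.sqrt (Real.log k) := hl0.trans_le hlog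
    rw [Real.sqrt_mul (by linarith), div_le_div_iff₀ (by positivity) (by positivity)]
    nlinarith
  · obtain ⟨Q, hQ, rfl⟩ := hM.1
    exact KWiseBits.majDev_le hn hk hk2 hkn hQ
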